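/- For a point $x$ and a nonempty compact convex set $Q$ in the plane $\mathbb{R}^2$, let $\alpha(x,Q)$ be the aperture angle: the angle of the smallest cone with apex $x$ that contains $Q$ if $x\notin Q$, and $\alpha(x,Q)=\pi$ if $x\in Q$. For a nonempty compact convex set $C$ and $Q\subseteq C$ put $\alpha(C,Q)=\inf_{x\in C}\alpha(x,Q)$. By an inscribed convex $k$-gon of $C$ we mean a convex polygon $Q\subseteq C$ with at most $k$ vertices, i.e. the convex hull of at least one and at most $k$ points of $C$ (points and segments are admitted as degenerate polygons). Let $\alpha(C,k)=\sup_Q\alpha(C,Q)$ over all inscribed convex $k$-gons $Q$ of $C$, and let $\alpha(k)=\inf_C\alpha(C,k)$ over all nonempty compact convex sets $C\subset\mathbb{R}^2$. Theorem. Let $k>2$ be an integer and $\alpha_k=\bigl(1-\frac{2}{k+1}\bigr)\pi$. (1) For every nonempty compact convex set $C\subset\mathbb{R}^2$ there is an inscribed convex $k$-gon $Q\subseteq C$ with $\alpha(C,Q)\ge\alpha_k$; if $C$ has nonempty interior, then $Q$ can be chosen with nonempty interior. (2) The bound is best possible: for every regular $(k+1)$-gon $P$, the maximum of $\alpha(P,Q)$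 over all inscribed convex $k$-gons $Q\subseteq P$ exists and equals $\alpha_k$. (3) Consequently $\alpha(k)=\alpha_k$. -/

import Mathlib

noncomputable section

namespace Aperture

/-- The Euclidean plane. -/
abbrev Plane : Type := EuclideanSpace ℝ (Fin 2)

/-- The closed cone (angular sector) with apex `x`, axis direction `u` and opening angle `θ`. -/
def cone (x u : Plane) (θ : ℝ) : Set Plane :=
  {y | y = x ∨ InnerProductGeometry.angle (y - x) u ≤ θ / 2}

open Classical in
/-- The aperture angle `α(x, Q)`: the angle of the smallest cone with apex `x` that contains `Q`
if `x ∉ Q`, and `π` if `x ∈ Q`. -/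
def apertureAngle (x : Plane) (Q : Set Plane) : ℝ :=
  if x ∈ Q then Real.pi
  else sInf {θ : ℝ | θ ∈ Set.Icc 0 (2 * Real.pi) ∧ ∃ u : Plane, u ≠ 0 ∧ Q ⊆ cone x u θ}

/-- `α(C, Q)`: the infimum of the aperture angles `α(x, Q)` over the points `x` of `C`. -/
def apertureOf (C Q : Set Plane) : ℝ :=
  sInf ((fun x => apertureAngle x Q) '' C)

/-- The convex polygons with at most `k` vertices that are contained in `C`, that is, the convex
hulls `Q ⊆ C` of nonempty sets of at most `k` points. -/
def inscribedPolygons (k : ℕ) (C : Set Plane) : Set (Set Plane) :=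
  {Q | Q ⊆ C ∧ ∃ V : Finset Plane, V.Nonempty ∧ V.card ≤ k ∧ Q = convexHull ℝ (V : Set Plane)}

/-- `α(C, k)`: the best value of `α(C, Q)` over the convex `k`-gons `Q` inscribed in `C`. -/
def bestAperture (C : Set Plane) (k : ℕ) : ℝ :=
  sSup ((fun Q => apertureOf C Q) '' inscribedPolygons k C)

/-- `α(k)`: the infimum of `α(C, k)` over all nonempty compact convex sets `C` in the plane. -/
def guaranteedAperture (k : ℕ) : ℝ :=
  sInf ((fun C => bestAperture C k) '' {C : Set Plane | IsCompact C ∧ Convex ℝ C ∧ C.Nonempty})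

/-- The regular `n`-gon with center `c` and circumradius `r`, rotated by the angle `φ`. -/
def regularPolygon (n : ℕ) (c : Plane) (r φ : ℝ) : Set Plane :=
  convexHull ℝ (Set.range fun j : Fin n =>
    c + r • (!₂[Real.cos (φ + 2 * Real.pi * (j : ℝ) / (n : ℝ)),
                Real.sin (φ + 2 * Real.pi * (j : ℝ) / (n : ℝ))] : Plane))

end Aperture

end

noncomputable section

namespace Aperture

/-! The lower bound rests on a statement about a finite convex polygon with vertex set `S`. Call an
angle wide if it is at least α_k. As k > 2, α_k ≥ π/2, so wide angles are non-acute and `τ = cot α_k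
≤ 0`. By the angle sum, a polygon with more than k vertices has a wide interior angle
(`exists_isEar`). Such a vertex with its two neighbours is an ear. Delete the ear with the largest
circumscribed circle and repeat until k vertices `V` remain.

Every deleted vertex then sees the chord between the surrounding consecutive vertices `a`, `b` of
`V` under a wide angle. This is an induction with step `covers_of_covers_erase`. Suppose the deleted
ear `u j w` fails. The other vertices on the arc lie strictly inside the circle `a j b`, so the
ear's circle is no larger than that circle (`circ_le_of_mem_disc`). If `w ≠ b`, the arc from `j` to
`b` contains an ear whose circle is at least that of a triangle on the chord `j b`
(`exists_isEar_of_minimal`); symmetrically if `u ≠ a`. Comparing circles contradicts the maximality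
of `u j w`.

`exists_wide_of_covers` passes from vertices to all points of the polygon outside the hull of `V`:
the function measuring failure to be wide is a squared norm plus an affine function, so failure at a
point forces failure at a vertex.

For a general compact `C`, the condition `Sees` is closed in the k-tuple of vertices, so the finite
case and compactness of C^k suffice (`exists_tuple_sees`).

For sharpness, an inscribed k-gon misses some vertex of the regular (k+1)-gon, and the whole
(k+1)-gon lies in the sector of angle α_k at that vertex (`regularPolygon_subset_sector`). -/

/-! ### Orientation, cotangents and circumscribed circles in coordinates. -/

/-- Twice the signed area of the triangle `a b c`. -/
def orient (a b c : Plane) : ℝ :=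
  (b 0 - a 0) * (c 1 - a 1) - (b 1 - a 1) * (c 0 - a 0)

/-- The inner product of `a - x` and `b - x`, in coordinates. -/
def dotAt (a x b : Plane) : ℝ :=
  (a 0 - x 0) * (b 0 - x 0) + (a 1 - x 1) * (b 1 - x 1)

/-- The squared distance, in coordinates. -/
def sqd (a b : Plane) : ℝ := (a 0 - b 0) ^ 2 + (a 1 - b 1) ^ 2

/-- The cotangent of the angle at `x` of a positively oriented triangle `a x b`. -/
def cotAt (a x b : Plane) : ℝ := dotAt a x b / orient a x b

/-- The squared diameter of the circumscribed circle of the triangle `a x b`. -/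
def circ (a x b : Plane) : ℝ := sqd a x * sqd x b * sqd a b / orient a x b ^ 2

/-- The power of `z` with respect to the circle through `a`, `x`, `b`, up to a factor that is
negative if `a x b` is positively oriented. -/
def circlePower (a x b z : Plane) : ℝ :=
  dotAt a x b * orient a z b - dotAt a z b * orient a x b

lemma orient_rotate (a b c : Plane) : orient b c a = orient a b c := by
  unfold orient; ring

lemma sqd_nonneg (a b : Plane) : 0 ≤ sqd a b := by unfold sqd; positivity

lemma sqd_comm (a b : Plane) : sqd a b = sqd b a := by unfold sqd; ring

lemma sqd_mul_sqd (a x b : Plane) :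
    sqd a x * sqd x b = orient a x b ^ 2 + dotAt a x b ^ 2 := by
  unfold sqd orient dotAt; ring

lemma circ_eq_base {a x b : Plane} (h : 0 < orient a x b) :
    circ a x b = sqd a b * (1 + cotAt a x b ^ 2) := by
  unfold circ cotAt
  rw [sqd_mul_sqd]
  field_simp

lemma circ_eq_left {a x b : Plane} (h : 0 < orient a x b) :
    circ a x b = sqd a x * (1 + cotAt x b a ^ 2) := by
  have h1 := sqd_mul_sqd x b a
  have h2 : orient x b a = orient a x b := orient_rotate a x b
  rw [h2, sqd_comm b a] at h1
  unfold circ cotAt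
  rw [h2, mul_assoc, h1]
  field_simp

lemma dotAt_mul_le {a y i b : Plane} (h : 0 ≤ orient y i b) :
    dotAt a y i * orient a y b ≤ dotAt a y b * orient a y i := by
  have : dotAt a y b * orient a y i - dotAt a y i * orient a y b = sqd a y * orient y i b := by
    unfold dotAt orient sqd; ring
  nlinarith [mul_nonneg (sqd_nonneg a y) h]

lemma dotAt_mul_le' {a y i b : Plane} (h : 0 ≤ orient a y i) :
    dotAt y i b * orient a i b ≤ dotAt a i b * orient y i b := by
  have : dotAt a i b * orient y i b - dotAt y i b * orient a i b = sqd i b * orient a y i := by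
    unfold dotAt orient sqd; ring
  nlinarith [mul_nonneg (sqd_nonneg i b) h]

lemma circlePower_eq (a y i b : Plane) :
    circlePower a i b y = -(dotAt a y i * orient i b a + dotAt i b a * orient a y i) := by
  unfold circlePower dotAt orient; ring

/-! ### Comparison of circumscribed circles. -/

lemma cotAt_le_cotAt_iff_circlePower {a x b z : Plane} (hx : 0 < orient a x b) (hz : 0 < orient a z b) :
    cotAt a z b ≤ cotAt a x b ↔ 0 ≤ circlePower a x b z := by
  unfold cotAt circlePower
  rw [div_le_div_iff₀ hz hx, sub_nonneg]

/-- `y` and `b` lie on opposite sides of the chord `a i`, so `y` is in the disc exactly when the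
cotangents at `y` and `b` have sum at most 0. If the angle at `b` is not obtuse, the cotangent at
`y` has the larger absolute value, and both squared diameters are `sqd a i` times 1 + cot². -/
lemma circ_le_of_circlePower {a y i b : Plane} (h1 : 0 < orient a y i) (h2 : 0 < orient a i b)
    (hp : 0 ≤ circlePower a i b y) (hb : 0 ≤ dotAt i b a) : circ a i b ≤ circ a y i := by
  have h3 : orient i b a = orient a i b := orient_rotate a i b
  rw [circ_eq_left h2, circ_eq_base h1]
  have hc : 0 ≤ cotAt i b a := div_nonneg hb (by rw [h3]; exact h2.le)
  have hle : cotAt a y i ≤ -cotAt i b a := by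
    rw [circlePower_eq, h3] at hp
    unfold cotAt
    rw [h3, ← neg_div, div_le_div_iff₀ h1 h2]
    linarith
  have : cotAt i b a ^ 2 ≤ cotAt a y i ^ 2 := by nlinarith
  exact mul_le_mul_of_nonneg_left (by linarith) (sqd_nonneg _ _)

lemma sqd_pos_of_orient {a y i : Plane} (h1 : 0 < orient a y i) : 0 < sqd a i := by
  refine lt_of_le_of_ne (sqd_nonneg _ _) fun h => ?_
  unfold sqd at h
  have e0 : a 0 - i 0 = 0 := by nlinarith [sq_nonneg (a 0 - i 0), sq_nonneg (a 1 - i 1)]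
  have e1 : a 1 - i 1 = 0 := by nlinarith [sq_nonneg (a 0 - i 0), sq_nonneg (a 1 - i 1)]
  unfold orient at h1
  have e0 : a 0 = i 0 := by linarith
  have e1 : a 1 = i 1 := by linarith
  rw [e0, e1] at h1
  nlinarith

lemma circ_lt_of_circlePower {a y i b : Plane} (h1 : 0 < orient a y i) (h2 : 0 < orient a i b)
    (hp : 0 < circlePower a i b y) (hb : 0 ≤ dotAt i b a) : circ a i b < circ a y i := by
  have h3 : orient i b a = orient a i b := orient_rotate a i b
  rw [circ_eq_left h2, circ_eq_base h1]
  have hc : 0 ≤ cotAt i b a := div_nonneg hb (by rw [h3]; exact h2.le)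
  have hle : cotAt a y i < -cotAt i b a := by
    rw [circlePower_eq, h3] at hp
    unfold cotAt
    rw [h3, ← neg_div, div_lt_div_iff₀ h1 h2]
    linarith
  have : cotAt i b a ^ 2 < cotAt a y i ^ 2 := by nlinarith
  exact mul_lt_mul_of_pos_left (by linarith) (sqd_pos_of_orient h1)

/-- With the common vertex at 0, M/X and N/Y are the points antipodal to 0 on the circles 0AB and
0UW, and `hU`, `hW` put U and W in the disc with diameter from 0 to M/X. Since U·W ≤ 0, YN is a
nonnegative combination of U and W. Combining `hU` and `hW` gives |N/Y|² ≤ (M/X)·(N/Y), and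
Cauchy–Schwarz finishes. -/
lemma circumradius_comparison {A0 A1 B0 B1 U0 U1 W0 W1 : ℝ}
    (hX : 0 < A1 * B0 - A0 * B1) (hY : 0 < U1 * W0 - U0 * W1) (hd : U0 * W0 + U1 * W1 ≤ 0)
    (hU : (A1 * B0 - A0 * B1) * (U0 ^ 2 + U1 ^ 2) ≤
      (A1 * (B0 ^ 2 + B1 ^ 2) - B1 * (A0 ^ 2 + A1 ^ 2)) * U0 +
      (B0 * (A0 ^ 2 + A1 ^ 2) - A0 * (B0 ^ 2 + B1 ^ 2)) * U1)
    (hW : (A1 * B0 - A0 * B1) * (W0 ^ 2 + W1 ^ 2) ≤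
      (A1 * (B0 ^ 2 + B1 ^ 2) - B1 * (A0 ^ 2 + A1 ^ 2)) * W0 +
      (B0 * (A0 ^ 2 + A1 ^ 2) - A0 * (B0 ^ 2 + B1 ^ 2)) * W1) :
    (U0 ^ 2 + U1 ^ 2) * (W0 ^ 2 + W1 ^ 2) * ((U0 - W0) ^ 2 + (U1 - W1) ^ 2) *
        (A1 * B0 - A0 * B1) ^ 2 ≤
      (A0 ^ 2 + A1 ^ 2) * (B0 ^ 2 + B1 ^ 2) * ((A0 - B0) ^ 2 + (A1 - B1) ^ 2) *
        (U1 * W0 - U0 * W1) ^ 2 := by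
  obtain ⟨X, eX⟩ : ∃ X, X = A1 * B0 - A0 * B1 := ⟨_, rfl⟩
  obtain ⟨Y, eY⟩ : ∃ Y, Y = U1 * W0 - U0 * W1 := ⟨_, rfl⟩
  obtain ⟨M0, eM0⟩ : ∃ M, M = A1 * (B0 ^ 2 + B1 ^ 2) - B1 * (A0 ^ 2 + A1 ^ 2) := ⟨_, rfl⟩
  obtain ⟨M1, eM1⟩ : ∃ M, M = B0 * (A0 ^ 2 + A1 ^ 2) - A0 * (B0 ^ 2 + B1 ^ 2) := ⟨_, rfl⟩
  obtain ⟨N0, eN0⟩ : ∃ M, M = U1 * (W0 ^ 2 + W1 ^ 2) - W1 * (U0 ^ 2 + U1 ^ 2) := ⟨_, rfl⟩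
  obtain ⟨N1, eN1⟩ : ∃ M, M = W0 * (U0 ^ 2 + U1 ^ 2) - U0 * (W0 ^ 2 + W1 ^ 2) := ⟨_, rfl⟩
  have hM : (A0 ^ 2 + A1 ^ 2) * (B0 ^ 2 + B1 ^ 2) * ((A0 - B0) ^ 2 + (A1 - B1) ^ 2) =
      M0 ^ 2 + M1 ^ 2 := by rw [eM0, eM1]; ring
  have hN : (U0 ^ 2 + U1 ^ 2) * (W0 ^ 2 + W1 ^ 2) * ((U0 - W0) ^ 2 + (U1 - W1) ^ 2) =
      N0 ^ 2 + N1 ^ 2 := by rw [eN0, eN1]; ring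
  have hNU : N0 * U0 + N1 * U1 = Y * (U0 ^ 2 + U1 ^ 2) := by rw [eN0, eN1, eY]; ring
  have hNW : N0 * W0 + N1 * W1 = Y * (W0 ^ 2 + W1 ^ 2) := by rw [eN0, eN1, eY]; ring
  have hcomb0 : Y * N0 = (W0 ^ 2 + W1 ^ 2) * (U0 ^ 2 + U1 ^ 2 - (U0 * W0 + U1 * W1)) * U0 +
      (U0 ^ 2 + U1 ^ 2) * (W0 ^ 2 + W1 ^ 2 - (U0 * W0 + U1 * W1)) * W0 := by
    rw [eN0, eY]; ring
  have hcomb1 : Y * N1 = (W0 ^ 2 + W1 ^ 2) * (U0 ^ 2 + U1 ^ 2 - (U0 * W0 + U1 * W1)) * U1 +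
      (U0 ^ 2 + U1 ^ 2) * (W0 ^ 2 + W1 ^ 2 - (U0 * W0 + U1 * W1)) * W1 := by
    rw [eN1, eY]; ring
  rw [← eX, ← eM0, ← eM1] at hU hW
  rw [← eX] at hX
  rw [← eY] at hY
  rw [hM, hN, ← eX, ← eY]
  have hu : 0 ≤ (W0 ^ 2 + W1 ^ 2) * (U0 ^ 2 + U1 ^ 2 - (U0 * W0 + U1 * W1)) :=
    mul_nonneg (by positivity) (by linarith [sq_nonneg U0, sq_nonneg U1])
  have hw : 0 ≤ (U0 ^ 2 + U1 ^ 2) * (W0 ^ 2 + W1 ^ 2 - (U0 * W0 + U1 * W1)) :=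
    mul_nonneg (by positivity) (by linarith [sq_nonneg W0, sq_nonneg W1])
  have key : 0 ≤ Y * (Y * (M0 * N0 + M1 * N1) - X * (N0 ^ 2 + N1 ^ 2)) := by
    have e : Y * (Y * (M0 * N0 + M1 * N1) - X * (N0 ^ 2 + N1 ^ 2)) =
        Y * ((W0 ^ 2 + W1 ^ 2) * (U0 ^ 2 + U1 ^ 2 - (U0 * W0 + U1 * W1)) *
          (M0 * U0 + M1 * U1 - X * (U0 ^ 2 + U1 ^ 2)) +
        (U0 ^ 2 + U1 ^ 2) * (W0 ^ 2 + W1 ^ 2 - (U0 * W0 + U1 * W1)) *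
          (M0 * W0 + M1 * W1 - X * (W0 ^ 2 + W1 ^ 2))) := by
      linear_combination (Y * M0 - X * N0) * hcomb0 + (Y * M1 - X * N1) * hcomb1 -
        X * (W0 ^ 2 + W1 ^ 2) * (U0 ^ 2 + U1 ^ 2 - (U0 * W0 + U1 * W1)) * hNU -
        X * (U0 ^ 2 + U1 ^ 2) * (W0 ^ 2 + W1 ^ 2 - (U0 * W0 + U1 * W1)) * hNW
    rw [e]
    exact mul_nonneg hY.le (add_nonneg (mul_nonneg hu (by linarith)) (mul_nonneg hw (by linarith)))
  have key2 : X * (N0 ^ 2 + N1 ^ 2) ≤ Y * (M0 * N0 + M1 * N1) := by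
    have := nonneg_of_mul_nonneg_right key hY
    linarith
  have cs : (Y * (M0 * N0 + M1 * N1)) ^ 2 ≤ Y ^ 2 * (M0 ^ 2 + M1 ^ 2) * (N0 ^ 2 + N1 ^ 2) := by
    have : Y ^ 2 * (M0 ^ 2 + M1 ^ 2) * (N0 ^ 2 + N1 ^ 2) - (Y * (M0 * N0 + M1 * N1)) ^ 2 =
        (Y * (M0 * N1 - M1 * N0)) ^ 2 := by ring
    linarith [sq_nonneg (Y * (M0 * N1 - M1 * N0))]
  have hn : 0 ≤ N0 ^ 2 + N1 ^ 2 := by positivity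
  rcases hn.eq_or_lt with h0 | h0
  · rw [← h0, zero_mul]; positivity
  · have h5 : (X * (N0 ^ 2 + N1 ^ 2)) ^ 2 ≤ (Y * (M0 * N0 + M1 * N1)) ^ 2 :=
      pow_le_pow_left₀ (by positivity) key2 2
    have h6 : (N0 ^ 2 + N1 ^ 2) * ((N0 ^ 2 + N1 ^ 2) * X ^ 2) ≤
        (N0 ^ 2 + N1 ^ 2) * ((M0 ^ 2 + M1 ^ 2) * Y ^ 2) := by linarith
    exact le_of_mul_le_mul_left h6 h0

/-- A triangle with a non-acute angle at `i` whose other vertices lie in a disc with `i` on the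
boundary has a circumscribed circle that is no larger than the disc. -/
lemma circ_le_of_mem_disc {a u i w b : Plane} (h1 : 0 < orient a i b) (h2 : 0 < orient u i w)
    (hd : dotAt u i w ≤ 0) (hu : 0 ≤ circlePower a i b u) (hw : 0 ≤ circlePower a i b w) :
    circ u i w ≤ circ a i b := by
  unfold circ
  rw [div_le_div_iff₀ (by positivity) (by positivity)]
  have := @circumradius_comparison (a 0 - i 0) (a 1 - i 1) (b 0 - i 0) (b 1 - i 1)
    (u 0 - i 0) (u 1 - i 1) (w 0 - i 0) (w 1 - i 1)
    (by unfold orient at h1; linarith) (by unfold orient at h2; linarith) hd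
    (by unfold circlePower dotAt orient at hu; linarith)
    (by unfold circlePower dotAt orient at hw; linarith)
  unfold sqd orient
  refine le_of_eq_of_le (by ring) (le_of_le_of_eq this (by ring))

/-- For vectors A, U, I: p = A·U, q = U·I, X = A×U, Y = U×I, t = A·I, and a, u, c are the squared
norms of A, U, I. Negative t forces pq < XY; squaring and `hpX`, `hqY` give p²c ≤ aY². The rest is
|U − I|² ≤ u and a < |A − I|². -/
lemma half_disc_scalar {p q X Y a c u t : ℝ} (hY : 0 < Y) (hup : u ≤ p) (hcq : c ≤ q)
    (hu : 0 < u) (hc : 0 < c) (hpX : p ^ 2 + X ^ 2 = a * u) (hqY : q ^ 2 + Y ^ 2 = u * c)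
    (ht : t < 0) (htu : t * u = p * q - X * Y) :
    (u - 2 * q + c) * c * u < (a + c - 2 * t) * Y ^ 2 := by
  have h1 : p * q ≤ X * Y := by linarith [mul_neg_of_neg_of_pos ht hu]
  have hpq : 0 ≤ p * q := mul_nonneg (by linarith) (by linarith)
  have h2 : (p * q) ^ 2 ≤ (X * Y) ^ 2 := pow_le_pow_left₀ hpq h1 2
  have h3 : u * (p ^ 2 * c) ≤ u * (a * Y ^ 2) := by
    have e : u * (a * Y ^ 2) - u * (p ^ 2 * c) = (X * Y) ^ 2 - (p * q) ^ 2 := by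
      linear_combination (-Y ^ 2) * hpX + p ^ 2 * hqY
    linarith
  have h4 : p ^ 2 * c ≤ a * Y ^ 2 := le_of_mul_le_mul_left h3 hu
  have h5 : u ^ 2 * c ≤ a * Y ^ 2 :=
    le_trans (mul_le_mul_of_nonneg_right (pow_le_pow_left₀ hu.le hup 2) hc.le) h4
  have h6 : (u - 2 * q + c) * (c * u) ≤ u * (c * u) :=
    mul_le_mul_of_nonneg_right (by linarith) (mul_pos hc hu).le
  have h7 : a * Y ^ 2 < (a + c - 2 * t) * Y ^ 2 :=
    mul_lt_mul_of_pos_right (by linarith) (by positivity)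
  linarith

lemma sq_add_sq_pos_of_cross {U0 U1 I0 I1 : ℝ} (h : 0 < U0 * I1 - U1 * I0) :
    0 < U0 ^ 2 + U1 ^ 2 := by
  refine lt_of_le_of_ne (by positivity) fun h0 => ?_
  have e0 : U0 = 0 := by nlinarith [sq_nonneg U0, sq_nonneg U1]
  have e1 : U1 = 0 := by nlinarith [sq_nonneg U0, sq_nonneg U1]
  simp [e0, e1] at h

lemma half_disc_comparison {A0 A1 U0 U1 I0 I1 : ℝ}
    (hUI : 0 < U0 * I1 - U1 * I0)
    (hAI : A0 * I0 + A1 * I1 < 0)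
    (hu : (A0 - U0) * (-U0) + (A1 - U1) * (-U1) ≤ 0)
    (hi : (U0 - I0) * (-I0) + (U1 - I1) * (-I1) ≤ 0) :
    ((U0 - I0) ^ 2 + (U1 - I1) ^ 2) * (I0 ^ 2 + I1 ^ 2) * (U0 ^ 2 + U1 ^ 2) <
      ((A0 - I0) ^ 2 + (A1 - I1) ^ 2) * (U0 * I1 - U1 * I0) ^ 2 := by
  have hI : 0 < I0 ^ 2 + I1 ^ 2 :=
    sq_add_sq_pos_of_cross (I0 := -U0) (I1 := -U1) (by linarith)
  have := @half_disc_scalar (A0 * U0 + A1 * U1) (U0 * I0 + U1 * I1) (A0 * U1 - A1 * U0)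
    (U0 * I1 - U1 * I0) (A0 ^ 2 + A1 ^ 2) (I0 ^ 2 + I1 ^ 2) (U0 ^ 2 + U1 ^ 2)
    (A0 * I0 + A1 * I1) hUI (by linarith) (by linarith) (sq_add_sq_pos_of_cross hUI) hI
    (by ring) (by ring) hAI (by ring)
  refine lt_of_eq_of_lt (by ring) (lt_of_lt_of_eq this (by ring))

/-- Comparison of the circle through `u`, `i`, `b` with the circle on the diameter `a i`, when the
angle at `b` of the triangle `a i b` is obtuse. -/
lemma circ_lt_sqd {a u i b : Plane} (h2 : 0 < orient u i b)
    (hb : dotAt i b a < 0) (hu : dotAt a u b ≤ 0) (hi : dotAt u i b ≤ 0) :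
    circ u i b < sqd a i := by
  unfold circ
  rw [div_lt_iff₀ (by positivity)]
  have := @half_disc_comparison (a 0 - b 0) (a 1 - b 1) (u 0 - b 0) (u 1 - b 1)
    (i 0 - b 0) (i 1 - b 1)
    (by unfold orient at h2; linarith)
    (by unfold dotAt at hb; linarith)
    (by unfold dotAt at hu; linarith)
    (by unfold dotAt at hi; linarith)
  unfold sqd orient
  refine lt_of_eq_of_lt (by ring) (lt_of_lt_of_eq this (by ring))

lemma sqd_le_circ {a y i : Plane} (h : 0 < orient a y i) : sqd a i ≤ circ a y i := by
  rw [circ_eq_base h]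
  nlinarith [sqd_nonneg a i, mul_nonneg (sqd_nonneg a i) (sq_nonneg (cotAt a y i))]

/-! ### Mirror images of the comparison lemmas. -/

/-- Reflection in the first coordinate axis. -/
def mirror (a : Plane) : Plane := !₂[a 0, -a 1]

lemma orient_mirror (a b c : Plane) :
    orient (mirror c) (mirror b) (mirror a) = orient a b c := by
  simp [orient, mirror]; ring

lemma dotAt_mirror (a b c : Plane) :
    dotAt (mirror c) (mirror b) (mirror a) = dotAt a b c := by
  simp [dotAt, mirror]; ring

lemma sqd_mirror (a b : Plane) : sqd (mirror b) (mirror a) = sqd a b := by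
  simp [sqd, mirror]; ring

lemma circ_mirror (a b c : Plane) :
    circ (mirror c) (mirror b) (mirror a) = circ a b c := by
  unfold circ
  rw [orient_mirror, sqd_mirror, sqd_mirror, sqd_mirror]; ring

lemma circlePower_mirror (a b c z : Plane) :
    circlePower (mirror c) (mirror b) (mirror a) (mirror z) = circlePower a b c z := by
  unfold circlePower
  simp only [orient_mirror, dotAt_mirror]

lemma circ_le_of_circlePower' {a y i b : Plane} (h1 : 0 < orient i y b) (h2 : 0 < orient a i b)
    (hp : 0 ≤ circlePower a i b y) (hb : 0 ≤ dotAt b a i) : circ a i b ≤ circ i y b := by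
  rw [← circ_mirror a i b, ← circ_mirror i y b]
  apply circ_le_of_circlePower
  · rwa [orient_mirror]
  · rwa [orient_mirror]
  · rwa [circlePower_mirror]
  · rwa [dotAt_mirror]

lemma circ_lt_of_circlePower' {a y i b : Plane} (h1 : 0 < orient i y b) (h2 : 0 < orient a i b)
    (hp : 0 < circlePower a i b y) (hb : 0 ≤ dotAt b a i) : circ a i b < circ i y b := by
  rw [← circ_mirror a i b, ← circ_mirror i y b]
  apply circ_lt_of_circlePower
  · rwa [orient_mirror]
  · rwa [orient_mirror]
  · rwa [circlePower_mirror]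
  · rwa [dotAt_mirror]

lemma circ_lt_sqd' {a w i b : Plane} (h2 : 0 < orient a i w)
    (hb : dotAt b a i < 0) (hu : dotAt a w b ≤ 0) (hi : dotAt a i w ≤ 0) :
    circ a i w < sqd i b := by
  rw [← circ_mirror a i w, ← sqd_mirror i b]
  apply circ_lt_sqd
  · rwa [orient_mirror]
  · rwa [dotAt_mirror]
  · rwa [dotAt_mirror]
  · rwa [dotAt_mirror]

lemma circlePower_left (a x b : Plane) : circlePower a x b a = 0 := by
  unfold circlePower orient dotAt; ring

lemma circlePower_right (a x b : Plane) : circlePower a x b b = 0 := by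
  unfold circlePower orient dotAt; ring

lemma dotAt_add_dotAt (a x b : Plane) : dotAt a x b + dotAt x b a = sqd x b := by
  unfold sqd dotAt; ring

/-! ### Cyclic order, wide angles and ears. -/

/-- The cyclic order of natural numbers: going upwards cyclically from `a`, one meets `b` strictly
before `c`. -/
def cyc (a b c : ℕ) : Prop := (a < b ∧ b < c) ∨ (b < c ∧ c < a) ∨ (c < a ∧ a < b)

instance (a b c : ℕ) : Decidable (cyc a b c) := by unfold cyc; infer_instance

/-- The points `p i`, `i ∈ S`, are in strictly convex position, and their order is
counterclockwise. -/
def ConvexSeq (p : ℕ → Plane) (S : Finset ℕ) : Prop :=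
  ∀ i ∈ S, ∀ j ∈ S, ∀ l ∈ S, i < j → j < l → 0 < orient (p i) (p j) (p l)

lemma ConvexSeq.mono {p : ℕ → Plane} {S T : Finset ℕ} (h : ConvexSeq p S) (hT : T ⊆ S) :
    ConvexSeq p T := fun i hi j hj l hl => h i (hT hi) j (hT hj) l (hT hl)

lemma ConvexSeq.orient_pos {p : ℕ → Plane} {S : Finset ℕ} (h : ConvexSeq p S) {i j l : ℕ}
    (hi : i ∈ S) (hj : j ∈ S) (hl : l ∈ S) (hc : cyc i j l) : 0 < orient (p i) (p j) (p l) := by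
  rcases hc with ⟨h1, h2⟩ | ⟨h1, h2⟩ | ⟨h1, h2⟩
  · exact h i hi j hj l hl h1 h2
  · rw [← orient_rotate]; exact h j hj l hl i hi h1 h2
  · rw [← orient_rotate, ← orient_rotate]; exact h l hl i hi j hj h1 h2

/-- The angle at `x` of the positively oriented triangle `a x b` has cotangent at most `τ`. -/
def Wide (τ : ℝ) (a x b : Plane) : Prop := dotAt a x b ≤ τ * orient a x b

lemma wide_iff_cotAt {τ : ℝ} {a x b : Plane} (h : 0 < orient a x b) :
    Wide τ a x b ↔ cotAt a x b ≤ τ := by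
  unfold Wide cotAt; rw [div_le_iff₀ h]

lemma Wide.dotAt_nonpos {τ : ℝ} {a x b : Plane} (hw : Wide τ a x b) (hτ : τ ≤ 0)
    (h : 0 < orient a x b) : dotAt a x b ≤ 0 :=
  hw.trans (mul_nonpos_of_nonpos_of_nonneg hτ h.le)

/-- In the convex quadrilateral `a y i b` the diagonal from `y` to `b` lies inside the angle `a y
i`. -/
lemma cotAt_le_of_far {a y i b : Plane} (h1 : 0 < orient a y i) (h2 : 0 < orient a y b)
    (h3 : 0 < orient y i b) : cotAt a y i ≤ cotAt a y b := by
  unfold cotAt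
  rw [div_le_div_iff₀ h1 h2]
  exact dotAt_mul_le h3.le

lemma cotAt_le_of_far' {a y i b : Plane} (h1 : 0 < orient y i b) (h2 : 0 < orient a i b)
    (h3 : 0 < orient a y i) : cotAt y i b ≤ cotAt a i b := by
  unfold cotAt
  rw [div_le_div_iff₀ h1 h2]
  exact dotAt_mul_le' h3.le

/-- Three consecutive indices of `S` whose middle angle is wide. -/
structure IsEar (p : ℕ → Plane) (τ : ℝ) (S : Finset ℕ) (u i w : ℕ) : Prop where
  left_mem : u ∈ S
  mem : i ∈ S
  right_mem : w ∈ S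
  cyc : cyc u i w
  left_gap : ∀ s ∈ S, ¬ Aperture.cyc u s i
  right_gap : ∀ s ∈ S, ¬ Aperture.cyc i s w
  wide : Wide τ (p u) (p i) (p w)

/-- If the angle over the chord `u w` is smallest at `i` among the points of `S` between `u` and
`w`, and is wide there, then some ear has a circumscribed circle at least as large as
that of `u i w`. -/
lemma exists_isEar_of_minimal {p : ℕ → Plane} {τ : ℝ} (hτ : τ ≤ 0) {S : Finset ℕ}
    (hS : ConvexSeq p S) (m : ℕ) : ∀ u i w : ℕ, u ∈ S → i ∈ S → w ∈ S → cyc u i w →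
    Wide τ (p u) (p i) (p w) →
    (∀ y ∈ S, cyc u y w → cotAt (p u) (p y) (p w) ≤ cotAt (p u) (p i) (p w)) →
    (S.filter fun y => cyc u y w).card ≤ m →
    ∃ u' i' w', IsEar p τ S u' i' w' ∧
      circ (p u) (p i) (p w) ≤ circ (p u') (p i') (p w') := by
  induction m with
  | zero =>
    intro u i w _ hi _ hc _ _ hm
    have : i ∈ S.filter fun y => cyc u y w := by simp [hi, hc]
    have := Finset.card_pos.2 ⟨i, this⟩
    omega
  | succ m ih =>
    intro u i w hu hi hw hc hwide hmin hm
    have o0 := hS.orient_pos hu hi hw hc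
    have hcot := (wide_iff_cotAt o0).1 hwide
    have hdot := hwide.dotAt_nonpos hτ o0
    by_cases hl : ∃ y ∈ S, cyc u y i
    -- Choosing the smallest angle over the shorter chord `u i` restores the minimality hypothesis
    -- for the recursion on this smaller arc.
    · obtain ⟨y, hy, hymax⟩ := Finset.exists_max_image (S.filter fun y => cyc u y i)
        (fun y => cotAt (p u) (p y) (p i)) (by obtain ⟨y, h1, h2⟩ := hl; exact ⟨y, by simp [h1, h2]⟩)
      rw [Finset.mem_filter] at hy
      obtain ⟨hyS, hyc⟩ := hy
      have c1 : cyc u y w := by unfold cyc at *; omega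
      have c2 : cyc y i w := by unfold cyc at *; omega
      have o1 := hS.orient_pos hu hyS hi hyc
      have o2 := hS.orient_pos hu hyS hw c1
      have o3 := hS.orient_pos hyS hi hw c2
      have hw' : Wide τ (p u) (p y) (p i) := (wide_iff_cotAt o1).2
        ((cotAt_le_of_far o1 o2 o3).trans ((hmin y hyS c1).trans hcot))
      obtain ⟨u', i', w', he, hle⟩ := ih u y i hu hyS hi hyc hw'
        (fun z hz hzc => hymax z (by simp [hz, hzc])) (by
          have : (S.filter fun y => cyc u y i) ⊂ S.filter fun y => cyc u y w := by
            rw [Finset.ssubset_iff_of_subset]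
            · exact ⟨i, by simp [hi, hc], fun h => by
                have := (Finset.mem_filter.1 h).2; unfold cyc at this; omega⟩
            · intro z hz
              simp only [Finset.mem_filter] at hz ⊢
              exact ⟨hz.1, by have := hz.2; unfold cyc at *; omega⟩
          have := Finset.card_lt_card this
          omega)
      refine ⟨u', i', w', he, le_trans (circ_le_of_circlePower o1 o0 ?_ ?_) hle⟩
      · exact (cotAt_le_cotAt_iff_circlePower o0 o2).1 (hmin y hyS c1)
      -- The angle at `i` is non-acute, so the angle at `w` is not obtuse, as the comparison
      -- requires.
      · linarith [dotAt_add_dotAt (p u) (p i) (p w), sqd_nonneg (p i) (p w)]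
    by_cases hr : ∃ y ∈ S, cyc i y w
    · obtain ⟨y, hy, hymax⟩ := Finset.exists_max_image (S.filter fun y => cyc i y w)
        (fun y => cotAt (p i) (p y) (p w)) (by obtain ⟨y, h1, h2⟩ := hr; exact ⟨y, by simp [h1, h2]⟩)
      rw [Finset.mem_filter] at hy
      obtain ⟨hyS, hyc⟩ := hy
      have c1 : cyc u y w := by unfold cyc at *; omega
      have c2 : cyc u i y := by unfold cyc at *; omega
      have o1 := hS.orient_pos hi hyS hw hyc
      have o2 := hS.orient_pos hu hyS hw c1
      have o3 := hS.orient_pos hu hi hyS c2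
      have hw' : Wide τ (p i) (p y) (p w) := (wide_iff_cotAt o1).2
        ((cotAt_le_of_far' o1 o2 o3).trans ((hmin y hyS c1).trans hcot))
      obtain ⟨u', i', w', he, hle⟩ := ih i y w hi hyS hw hyc hw'
        (fun z hz hzc => hymax z (by simp [hz, hzc])) (by
          have : (S.filter fun y => cyc i y w) ⊂ S.filter fun y => cyc u y w := by
            rw [Finset.ssubset_iff_of_subset]
            · exact ⟨i, by simp [hi, hc], fun h => by
                have := (Finset.mem_filter.1 h).2; unfold cyc at this; omega⟩
            · intro z hz
              simp only [Finset.mem_filter] at hz ⊢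
              exact ⟨hz.1, by have := hz.2; unfold cyc at *; omega⟩
          have := Finset.card_lt_card this
          omega)
      refine ⟨u', i', w', he, le_trans (circ_le_of_circlePower' o1 o0 ?_ ?_) hle⟩
      · exact (cotAt_le_cotAt_iff_circlePower o0 o2).1 (hmin y hyS c1)
      · have : dotAt (p w) (p u) (p i) + dotAt (p u) (p i) (p w) = sqd (p u) (p i) := by
          unfold dotAt sqd; ring
        linarith [sqd_nonneg (p u) (p i)]
    push Not at hl hr
    exact ⟨u, i, w, ⟨hu, hi, hw, hc, hl, hr, hwide⟩, le_rfl⟩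

/-! ### Deleting the ear with the largest circle. -/

/-- The arcs cut off by consecutive elements of `V` contain only indices of `S` at which the chord
is seen under a wide angle. -/
def Covers (p : ℕ → Plane) (τ : ℝ) (S V : Finset ℕ) : Prop :=
  ∀ a ∈ V, ∀ b ∈ V, (∀ v ∈ V, ¬ cyc a v b) → ∀ i ∈ S, cyc a i b → Wide τ (p a) (p i) (p b)

/-- If every point between `a` and `b` sees the chord `a b` under a wide angle, then some ear has a
circumscribed circle that is at least that of a triangle on the chord `a i`. -/
lemma exists_isEar_left {p : ℕ → Plane} {τ : ℝ} (hτ : τ ≤ 0) {S : Finset ℕ}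
    (hS : ConvexSeq p S) {a i b : ℕ} (ha : a ∈ S) (hi : i ∈ S) (hb : b ∈ S) (hc : cyc a i b)
    (hwide : ∀ y ∈ S, y ≠ i → cyc a y b → Wide τ (p a) (p y) (p b))
    (hne : ∃ y ∈ S, cyc a y i) :
    ∃ y ∈ S, cyc a y i ∧ ∃ u' i' w', IsEar p τ S u' i' w' ∧
      circ (p a) (p y) (p i) ≤ circ (p u') (p i') (p w') := by
  obtain ⟨y, hy, hymax⟩ := Finset.exists_max_image (S.filter fun y => cyc a y i)
    (fun y => cotAt (p a) (p y) (p i)) (by obtain ⟨y, h1, h2⟩ := hne; exact ⟨y, by simp [h1, h2]⟩)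
  rw [Finset.mem_filter] at hy
  obtain ⟨hyS, hyc⟩ := hy
  have c1 : cyc a y b := by unfold cyc at *; omega
  have c2 : cyc y i b := by unfold cyc at *; omega
  have hyi : y ≠ i := by unfold cyc at *; omega
  have o1 := hS.orient_pos ha hyS hi hyc
  have o2 := hS.orient_pos ha hyS hb c1
  have o3 := hS.orient_pos hyS hi hb c2
  exact ⟨y, hyS, hyc, exists_isEar_of_minimal hτ hS _ a y i ha hyS hi hyc
    ((wide_iff_cotAt o1).2 ((cotAt_le_of_far o1 o2 o3).trans
      ((wide_iff_cotAt o2).1 (hwide y hyS hyi c1))))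
    (fun z hz hzc => hymax z (by simp [hz, hzc])) le_rfl⟩

lemma exists_isEar_right {p : ℕ → Plane} {τ : ℝ} (hτ : τ ≤ 0) {S : Finset ℕ}
    (hS : ConvexSeq p S) {a i b : ℕ} (ha : a ∈ S) (hi : i ∈ S) (hb : b ∈ S) (hc : cyc a i b)
    (hwide : ∀ y ∈ S, y ≠ i → cyc a y b → Wide τ (p a) (p y) (p b))
    (hne : ∃ y ∈ S, cyc i y b) :
    ∃ y ∈ S, cyc i y b ∧ ∃ u' i' w', IsEar p τ S u' i' w' ∧
      circ (p i) (p y) (p b) ≤ circ (p u') (p i') (p w') := by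
  obtain ⟨y, hy, hymax⟩ := Finset.exists_max_image (S.filter fun y => cyc i y b)
    (fun y => cotAt (p i) (p y) (p b)) (by obtain ⟨y, h1, h2⟩ := hne; exact ⟨y, by simp [h1, h2]⟩)
  rw [Finset.mem_filter] at hy
  obtain ⟨hyS, hyc⟩ := hy
  have c1 : cyc a y b := by unfold cyc at *; omega
  have c2 : cyc a i y := by unfold cyc at *; omega
  have hyi : y ≠ i := by unfold cyc at *; omega
  have o1 := hS.orient_pos hi hyS hb hyc
  have o2 := hS.orient_pos ha hyS hb c1
  have o3 := hS.orient_pos ha hi hyS c2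
  exact ⟨y, hyS, hyc, exists_isEar_of_minimal hτ hS _ i y b hi hyS hb hyc
    ((wide_iff_cotAt o1).2 ((cotAt_le_of_far' o1 o2 o3).trans
      ((wide_iff_cotAt o2).1 (hwide y hyS hyi c1))))
    (fun z hz hzc => hymax z (by simp [hz, hzc])) le_rfl⟩

/-- Removing the ear with the largest circumscribed circle: what covers the rest covers the ear. -/
lemma covers_of_covers_erase {p : ℕ → Plane} {τ : ℝ} (hτ : τ ≤ 0) {S : Finset ℕ}
    (hS : ConvexSeq p S) {u i w : ℕ} (he : IsEar p τ S u i w)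
    (hmax : ∀ u' i' w', IsEar p τ S u' i' w' →
      circ (p u') (p i') (p w') ≤ circ (p u) (p i) (p w))
    {V : Finset ℕ} (hV : V ⊆ S.erase i) (hcov : Covers p τ (S.erase i) V) : Covers p τ S V := by
  intro a haV b hbV hab j hj hcj
  by_cases hji : j = i
  swap
  · exact hcov a haV b hbV hab j (Finset.mem_erase.2 ⟨hji, hj⟩) hcj
  subst hji
  obtain ⟨hu, hi, hw, hc, hgl, hgr, hwide⟩ := he
  obtain ⟨hai, ha⟩ := Finset.mem_erase.1 (hV haV)
  obtain ⟨hbi, hb⟩ := Finset.mem_erase.1 (hV hbV)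
  by_contra hnot
  have o0 := hS.orient_pos ha hi hb hcj
  have ou := hS.orient_pos hu hi hw hc
  have hother : ∀ y ∈ S, y ≠ j → cyc a y b → Wide τ (p a) (p y) (p b) := fun y hy hyj hyc =>
    hcov a haV b hbV hab y (Finset.mem_erase.2 ⟨hyj, hy⟩) hyc
  -- The other vertices on the arc see `a b` under a larger angle than `j` does, hence lie strictly
  -- inside the circle `a j b`.
  have hpower : ∀ y ∈ S, y ≠ j → cyc a y b → 0 < circlePower (p a) (p j) (p b) (p y) := by
    intro y hy hyj hyc
    have o1 := hS.orient_pos ha hy hb hyc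
    have h1 := (wide_iff_cotAt o1).1 (hother y hy hyj hyc)
    rw [wide_iff_cotAt o0, not_le] at hnot
    have h2 := h1.trans_lt hnot
    unfold cotAt at h2
    rw [div_lt_div_iff₀ o1 o0] at h2
    unfold circlePower
    linarith
  have hgla := hgl a ha
  have hgrb := hgr b hb
  have hcu : u ≠ a → cyc a u j := by intro h; unfold cyc at *; omega
  have hcw : w ≠ b → cyc j w b := by intro h; unfold cyc at *; omega
  have hcu' : u ≠ a → cyc a u b := by intro h; have := hcu h; unfold cyc at *; omega
  have hcw' : w ≠ b → cyc a w b := by intro h; have := hcw h; unfold cyc at *; omega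
  have huj : u ≠ j := by unfold cyc at hc; omega
  have hwj : w ≠ j := by unfold cyc at hc; omega
  have hpu : 0 ≤ circlePower (p a) (p j) (p b) (p u) := by
    by_cases h : u = a
    · rw [h, circlePower_left]
    · exact (hpower u hu huj (hcu' h)).le
  have hpw : 0 ≤ circlePower (p a) (p j) (p b) (p w) := by
    by_cases h : w = b
    · rw [h, circlePower_right]
    · exact (hpower w hw hwj (hcw' h)).le
  have hdot := hwide.dotAt_nonpos hτ ou
  have hK := circ_le_of_mem_disc o0 ou hdot hpu hpw
  -- If the angle at `a` were not obtuse, the ear found between `j` and `b` would have a circle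
  -- larger than that of `a j b`, hence by `hK` larger than that of `u j w`.
  have hright : w ≠ b → dotAt (p b) (p a) (p j) < 0 := by
    intro hwb
    obtain ⟨y, hyS, hyc, u', i', w', he', hle⟩ :=
      exists_isEar_right hτ hS ha hi hb hcj hother ⟨w, hw, hcw hwb⟩
    have hle := hle.trans (hmax _ _ _ he')
    by_contra hd
    have := circ_lt_of_circlePower' (hS.orient_pos hi hyS hb hyc) o0
      (hpower y hyS (by unfold cyc at *; omega) (by unfold cyc at *; omega)) (not_lt.1 hd)
    linarith
  have hleft : u ≠ a → dotAt (p j) (p b) (p a) < 0 := by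
    intro hua
    obtain ⟨y, hyS, hyc, u', i', w', he', hle⟩ :=
      exists_isEar_left hτ hS ha hi hb hcj hother ⟨u, hu, hcu hua⟩
    have hle := hle.trans (hmax _ _ _ he')
    by_contra hd
    have := circ_lt_of_circlePower (hS.orient_pos ha hyS hi hyc) o0
      (hpower y hyS (by unfold cyc at *; omega) (by unfold cyc at *; omega)) (not_lt.1 hd)
    linarith
  -- The triangle `a j b` cannot be obtuse at both `a` and `b`, which settles the case that both
  -- neighbours differ from the chord's ends. If only `w ≠ b`, the maximal circle is smaller than
  -- the one with diameter `j b`, while the ear between `j` and `b` has a circle at least that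
  -- large; the case `u ≠ a` is symmetric.
  by_cases hua : u = a
  · by_cases hwb : w = b
    · rw [hua, hwb] at hwide; exact hnot hwide
    obtain ⟨y, hyS, hyc, u', i', w', he', hle⟩ :=
      exists_isEar_right hτ hS ha hi hb hcj hother ⟨w, hw, hcw hwb⟩
    have hle := hle.trans (hmax _ _ _ he')
    rw [hua] at hle hdot ou
    have h1 := circ_lt_sqd' ou (hright hwb) ((hother w hw hwj (hcw' hwb)).dotAt_nonpos hτ
      (hS.orient_pos ha hw hb (hcw' hwb))) hdot
    have h2 := sqd_le_circ (hS.orient_pos hi hyS hb hyc)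
    linarith
  · by_cases hwb : w = b
    · obtain ⟨y, hyS, hyc, u', i', w', he', hle⟩ :=
        exists_isEar_left hτ hS ha hi hb hcj hother ⟨u, hu, hcu hua⟩
      have hle := hle.trans (hmax _ _ _ he')
      rw [hwb] at hle hdot ou
      have h1 := circ_lt_sqd ou (hleft hua) ((hother u hu huj (hcu' hua)).dotAt_nonpos hτ
        (hS.orient_pos ha hu hb (hcu' hua))) hdot
      have h2 := sqd_le_circ (hS.orient_pos ha hyS hi hyc)
      linarith
    · have := dotAt_add_dotAt (p j) (p b) (p a)
      linarith [hleft hua, hright hwb, sqd_nonneg (p b) (p a)]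

/-- If all subsets of `S` with more than `k` elements have an ear, then some subset with `k`
elements covers `S`. -/
theorem exists_covers {p : ℕ → Plane} {τ : ℝ} (hτ : τ ≤ 0) {k : ℕ} (n : ℕ) : ∀ S : Finset ℕ,
    S.card = k + n → ConvexSeq p S →
    (∀ T ⊆ S, k < T.card → ∃ u i w, IsEar p τ T u i w) →
    ∃ V ⊆ S, V.card = k ∧ Covers p τ S V := by
  induction n with
  | zero =>
    intro S hcard _ _
    exact ⟨S, subset_rfl, hcard, fun a _ b _ h i hi hc => absurd hc (h i hi)⟩
  | succ n ih =>
    intro S hcard hS hear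
    obtain ⟨u₀, i₀, w₀, he₀⟩ := hear S subset_rfl (by omega)
    classical
    obtain ⟨⟨u, i, w⟩, he, hmax⟩ := Finset.exists_max_image
      ((S ×ˢ S ×ˢ S).filter fun t => IsEar p τ S t.1 t.2.1 t.2.2)
      (fun t => circ (p t.1) (p t.2.1) (p t.2.2))
      ⟨(u₀, i₀, w₀), by simp [he₀.left_mem, he₀.mem, he₀.right_mem, he₀]⟩
    have he : IsEar p τ S u i w := (Finset.mem_filter.1 he).2
    obtain ⟨V, hV, hVcard, hcov⟩ := ih (S.erase i)
      (by rw [Finset.card_erase_of_mem he.mem]; omega) (hS.mono (Finset.erase_subset _ _))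
      (fun T hT => hear T (hT.trans (Finset.erase_subset _ _)))
    refine ⟨V, hV.trans (Finset.erase_subset _ _), hVcard,
      covers_of_covers_erase hτ hS he (fun u' i' w' he' => ?_) hV hcov⟩
    exact hmax (u', i', w') (by simp [he'.left_mem, he'.mem, he'.right_mem, he'])

/-! ### From cotangents to angles; the angle sum. -/

open EuclideanGeometry

lemma inner_sub_sub (a x b : Plane) : inner ℝ (a - x) (b - x) = dotAt a x b := by
  simp [PiLp.inner_apply, Fin.sum_univ_two, dotAt]; ring

lemma norm_mul_norm_sq (a x b : Plane) :
    (‖a - x‖ * ‖b - x‖) ^ 2 = orient a x b ^ 2 + dotAt a x b ^ 2 := by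
  have h1 : ‖a - x‖ ^ 2 = sqd a x := by
    rw [← real_inner_self_eq_norm_sq, inner_sub_sub]; unfold dotAt sqd; ring
  have h2 : ‖b - x‖ ^ 2 = sqd x b := by
    rw [← real_inner_self_eq_norm_sq, inner_sub_sub]; unfold dotAt sqd; ring
  rw [mul_pow, h1, h2, sqd_mul_sqd]

lemma dotAt_eq_cos (a x b : Plane) :
    dotAt a x b = ‖a - x‖ * ‖b - x‖ * Real.cos (∠ a x b) := by
  rw [← inner_sub_sub, ← InnerProductGeometry.cos_angle_mul_norm_mul_norm]
  unfold EuclideanGeometry.angle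
  simp only [vsub_eq_sub]
  ring

lemma orient_eq_sin {a x b : Plane} (h : 0 ≤ orient a x b) :
    orient a x b = ‖a - x‖ * ‖b - x‖ * Real.sin (∠ a x b) := by
  have h1 := norm_mul_norm_sq a x b
  have h2 := dotAt_eq_cos a x b
  have hs : 0 ≤ Real.sin (∠ a x b) := Real.sin_nonneg_of_nonneg_of_le_pi
    (EuclideanGeometry.angle_nonneg _ _ _) (EuclideanGeometry.angle_le_pi _ _ _)
  refine (sq_eq_sq₀ h (by positivity)).1 ?_
  rw [h2] at h1
  have := Real.sin_sq_add_cos_sq (∠ a x b)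
  linear_combination (-1) * h1 - (‖a - x‖ * ‖b - x‖) ^ 2 * this

lemma norm_mul_norm_pos {a x b : Plane} (h : 0 < orient a x b) : 0 < ‖a - x‖ * ‖b - x‖ := by
  refine lt_of_le_of_ne (by positivity) fun h0 => ?_
  rw [orient_eq_sin h.le, ← h0] at h
  simp at h

/-- The cotangent bound is an angle bound. -/
lemma wide_iff_le_angle {α : ℝ} (h0 : 0 < α) (h1 : α < Real.pi) {a x b : Plane}
    (h : 0 < orient a x b) : Wide (Real.cot α) a x b ↔ α ≤ ∠ a x b := by
  have hs := Real.sin_pos_of_pos_of_lt_pi h0 h1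
  have hN := norm_mul_norm_pos h
  have e : Wide (Real.cot α) a x b ↔ 0 ≤ Real.sin (∠ a x b - α) := by
    unfold Wide
    rw [Real.cot_eq_cos_div_sin, div_mul_eq_mul_div, le_div_iff₀ hs, orient_eq_sin h.le,
      dotAt_eq_cos, Real.sin_sub, ← sub_nonneg,
      ← mul_nonneg_iff_of_pos_left (b := Real.sin (∠ a x b) * Real.cos α - _) hN]
    rw [show Real.cos α * (‖a - x‖ * ‖b - x‖ * Real.sin (∠ a x b)) -
        ‖a - x‖ * ‖b - x‖ * Real.cos (∠ a x b) * Real.sin α = ‖a - x‖ * ‖b - x‖ *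
        (Real.sin (∠ a x b) * Real.cos α - Real.cos (∠ a x b) * Real.sin α) by ring]
  rw [e]
  have hθ0 := EuclideanGeometry.angle_nonneg a x b
  have hθ1 := EuclideanGeometry.angle_le_pi a x b
  constructor
  · intro h2
    by_contra hlt
    have := Real.sin_neg_of_neg_of_neg_pi_lt (x := ∠ a x b - α) (by linarith) (by linarith)
    linarith
  · intro h2
    exact Real.sin_nonneg_of_nonneg_of_le_pi (by linarith) (by linarith)

lemma angle_eq_add {a x m b : Plane} (h1 : 0 < orient a x m) (h2 : 0 < orient m x b)
    (h3 : 0 < orient a x b) : ∠ a x b = ∠ a x m + ∠ m x b := by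
  have n1 := norm_mul_norm_pos h1
  have hm : 0 < ‖m - x‖ := pos_of_mul_pos_right n1 (norm_nonneg _)
  have ha : 0 < ‖a - x‖ := pos_of_mul_pos_left n1 (norm_nonneg _)
  have hb : 0 < ‖b - x‖ := pos_of_mul_pos_right (norm_mul_norm_pos h3) (norm_nonneg _)
  have hmm : sqd m x = ‖m - x‖ ^ 2 := by
    rw [← real_inner_self_eq_norm_sq, inner_sub_sub]; unfold dotAt sqd; ring
  have hcos : Real.cos (∠ a x m + ∠ m x b) = Real.cos (∠ a x b) := by
    have e : sqd m x * dotAt a x b = dotAt a x m * dotAt m x b - orient a x m * orient m x b := by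
      unfold sqd dotAt orient; ring
    rw [dotAt_eq_cos, dotAt_eq_cos, dotAt_eq_cos, orient_eq_sin h1.le, orient_eq_sin h2.le,
      hmm] at e
    rw [Real.cos_add]
    have hne : ‖m - x‖ ^ 2 * (‖a - x‖ * ‖b - x‖) ≠ 0 := by positivity
    apply mul_left_cancel₀ hne
    linarith
  have hsin : 0 < Real.sin (∠ a x m + ∠ m x b) := by
    have e : sqd m x * orient a x b = dotAt a x m * orient m x b + orient a x m * dotAt m x b := by
      unfold sqd dotAt orient; ring
    rw [dotAt_eq_cos, dotAt_eq_cos, orient_eq_sin h1.le, orient_eq_sin h2.le, hmm] at e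
    rw [Real.sin_add]
    have hne : 0 < ‖m - x‖ ^ 2 * (‖a - x‖ * ‖b - x‖) := by positivity
    have hp : 0 < ‖m - x‖ ^ 2 * orient a x b := by positivity
    refine pos_of_mul_pos_right (a := ‖m - x‖ ^ 2 * (‖a - x‖ * ‖b - x‖)) ?_ hne.le
    linarith
  -- Equal cosines identify angles only within [0, π]; the positive sine excludes a sum beyond π.
  have hle : ∠ a x m + ∠ m x b ≤ Real.pi := by
    by_contra hlt
    have l1 := EuclideanGeometry.angle_le_pi a x m
    have l2 := EuclideanGeometry.angle_le_pi m x b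
    have := Real.sin_nonneg_of_nonneg_of_le_pi (x := ∠ a x m + ∠ m x b - Real.pi)
      (by linarith) (by linarith)
    rw [Real.sin_sub_pi] at this
    linarith
  exact Real.injOn_cos ⟨EuclideanGeometry.angle_nonneg _ _ _, EuclideanGeometry.angle_le_pi _ _ _⟩
    ⟨add_nonneg (EuclideanGeometry.angle_nonneg _ _ _) (EuclideanGeometry.angle_nonneg _ _ _), hle⟩
    hcos.symm

/-- The angle sum of a convex polygon. -/
lemma sum_angles {q : ℕ → Plane} (t : ℕ) (hq : ConvexSeq q (Finset.range (t + 3))) :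
    ∑ j ∈ Finset.range (t + 1), ∠ (q j) (q (j + 1)) (q (j + 2)) +
      ∠ (q (t + 1)) (q (t + 2)) (q 0) + ∠ (q (t + 2)) (q 0) (q 1) = (t + 1) * Real.pi := by
  have triangle : ∀ {a b c : Plane}, 0 < orient a b c →
      ∠ a b c + ∠ b c a + ∠ c a b = Real.pi := by
    intro a b c h
    refine EuclideanGeometry.angle_add_angle_add_angle_eq_pi (p₁ := a) (p₂ := b) c ?_
    rintro rfl
    simp [orient] at h
  induction t with
  | zero =>
    have h := hq 0 (by simp) 1 (by simp) 2 (by simp) (by norm_num) (by norm_num)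
    simpa using triangle h
  | succ t ih =>
    have ih := ih (hq.mono (by simp))
    have o : ∀ i j l, l < t + 4 → i < j → j < l → 0 < orient (q i) (q j) (q l) := by
      intro i j l hl hij hjl
      exact hq i (by simp; omega) j (by simp; omega) l (by simp; omega) hij hjl
    have h1 := o (t + 1) (t + 2) (t + 3) (by omega) (by omega) (by omega)
    have h2 := o 0 (t + 2) (t + 3) (by omega) (by omega) (by omega)
    have h3 := o 0 (t + 1) (t + 2) (by omega) (by omega) (by omega)
    have h4 := o 0 1 (t + 3) (by omega) (by omega) (by omega)
    have h5 := o 0 1 (t + 2) (by omega) (by omega) (by omega)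
    -- The diagonal from `q 0` to `q (t + 2)` cuts off a triangle with third vertex `q (t + 3)` and
    -- splits the angles at its two ends.
    have e1 := angle_eq_add (m := q 0) (by rwa [orient_rotate]) h2 h1
    rw [← orient_rotate, ← orient_rotate] at h4 h5
    have e2 := angle_eq_add (a := q (t + 3)) (x := q 0) (m := q (t + 2)) (b := q 1)
      (by rwa [← orient_rotate, ← orient_rotate] at h2) h5 h4
    have e3 := triangle h2
    rw [Finset.sum_range_succ]
    push_cast
    have e4 : ∠ (q (t + 2)) (q (t + 3)) (q 0) + ∠ (q 0) (q (t + 2)) (q (t + 3)) +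
        ∠ (q (t + 3)) (q 0) (q (t + 2)) = Real.pi := by linarith
    rw [show t + 1 + 1 = t + 2 from rfl, show t + 1 + 2 = t + 3 from rfl] at *
    linarith

/-- A convex polygon with more than `k` vertices has an interior angle of at least
`(1 - 2 / (k + 1)) π`. -/
lemma exists_isEar {p : ℕ → Plane} {k : ℕ} (hk : 2 ≤ k) {T : Finset ℕ} (hT : ConvexSeq p T)
    (hcard : k < T.card) :
    ∃ u i w, IsEar p (Real.cot ((1 - 2 / ((k : ℝ) + 1)) * Real.pi)) T u i w := by
  set α := (1 - 2 / ((k : ℝ) + 1)) * Real.pi with hα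
  have hk' : (2 : ℝ) ≤ k := by exact_mod_cast hk
  have hα0 : 0 < α := by
    apply mul_pos _ Real.pi_pos
    rw [sub_pos, div_lt_one (by linarith)]; linarith
  have hα1 : α < Real.pi := by
    have : 0 < 2 / ((k : ℝ) + 1) := by positivity
    nlinarith [Real.pi_pos]
  obtain ⟨t, ht⟩ : ∃ t, T.card = t + 3 := ⟨T.card - 3, by omega⟩
  let f := T.orderEmbOfFin ht
  -- `e` lists `T` increasingly; the value 0 past the end is never used.
  let e : ℕ → ℕ := fun j => if h : j < t + 3 then f ⟨j, h⟩ else 0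
  have he : ∀ j (h : j < t + 3), e j = f ⟨j, h⟩ := fun j h => by simp [e, h]
  have hemem : ∀ j, j < t + 3 → e j ∈ T := fun j h => by
    rw [he j h]; exact Finset.orderEmbOfFin_mem _ _ _
  have hemono : ∀ i j, i < j → j < t + 3 → e i < e j := fun i j hij hj => by
    rw [he i (by omega), he j hj]; exact f.lt_iff_lt.2 hij
  have hesurj : ∀ s ∈ T, ∃ j, j < t + 3 ∧ e j = s := fun s hs => by
    have : s ∈ Set.range f := by rw [Finset.range_orderEmbOfFin]; exact hs
    obtain ⟨⟨j, hj⟩, h⟩ := this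
    exact ⟨j, hj, by rw [he j hj]; exact h⟩
  have hele : ∀ i j, i ≤ j → j < t + 3 → e i ≤ e j := fun i j hij hj => by
    rcases hij.eq_or_lt with h | h
    · rw [h]
    · exact (hemono i j h hj).le
  have hq : ConvexSeq (fun j => p (e j)) (Finset.range (t + 3)) := by
    intro i _ j _ l hl hij hjl
    have hl := Finset.mem_range.1 hl
    exact hT _ (hemem i (by omega)) _ (hemem j (by omega)) _ (hemem l hl)
      (hemono i j hij (by omega)) (hemono j l hjl hl)
  have hsum := sum_angles t hq
  by_contra hno
  push Not at hno
  have hsmall : ∀ u i w, u ∈ T → i ∈ T → w ∈ T → cyc u i w → (∀ s ∈ T, ¬ cyc u s i) →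
      (∀ s ∈ T, ¬ cyc i s w) → ∠ (p u) (p i) (p w) < α := by
    intro u i w hu hi hw hc h1 h2
    by_contra hge
    exact hno u i w ⟨hu, hi, hw, hc, h1, h2,
      (wide_iff_le_angle hα0 hα1 (hT.orient_pos hu hi hw hc)).2 (not_lt.1 hge)⟩
  have hgap : ∀ j, j + 1 < t + 3 → ∀ s ∈ T, ¬ cyc (e j) s (e (j + 1)) := by
    intro j hj s hs hc
    obtain ⟨l, hl, rfl⟩ := hesurj s hs
    have := hemono j (j + 1) (by omega) hj
    rcases Nat.lt_or_ge j l with h | h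
    · have := hele (j + 1) l h hl
      unfold cyc at hc; omega
    · have := hele l j h (by omega)
      unfold cyc at hc; omega
  have hgap' : ∀ s ∈ T, ¬ cyc (e (t + 2)) s (e 0) := by
    intro s hs hc
    obtain ⟨l, hl, rfl⟩ := hesurj s hs
    have := hele 0 l (by omega) hl
    have := hele l (t + 2) (by omega) (by omega)
    unfold cyc at hc; omega
  have b1 : ∀ j ∈ Finset.range (t + 1),
      ∠ (p (e j)) (p (e (j + 1))) (p (e (j + 2))) ≤ α := by
    intro j hj
    have hj := Finset.mem_range.1 hj
    refine (hsmall _ _ _ (hemem _ (by omega)) (hemem _ (by omega)) (hemem _ (by omega)) ?_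
      (hgap j (by omega)) (show ∀ s ∈ T, ¬ cyc (e (j + 1)) s (e (j + 2)) from
        hgap (j + 1) (by omega))).le
    have := hemono j (j + 1) (by omega) (by omega)
    have := hemono (j + 1) (j + 2) (by omega) (by omega)
    unfold cyc; omega
  have b2 : ∠ (p (e (t + 1))) (p (e (t + 2))) (p (e 0)) < α := by
    refine hsmall _ _ _ (hemem _ (by omega)) (hemem _ (by omega)) (hemem _ (by omega)) ?_
      (show ∀ s ∈ T, ¬ cyc (e (t + 1)) s (e (t + 2)) from hgap (t + 1) (by omega)) hgap'
    have := hemono 0 (t + 1) (by omega) (by omega)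
    have := hemono (t + 1) (t + 2) (by omega) (by omega)
    unfold cyc; omega
  have b3 : ∠ (p (e (t + 2))) (p (e 0)) (p (e 1)) < α := by
    refine hsmall _ _ _ (hemem _ (by omega)) (hemem _ (by omega)) (hemem _ (by omega)) ?_
      hgap' (show ∀ s ∈ T, ¬ cyc (e 0) s (e 1) from hgap 0 (by omega))
    have := hemono 0 1 (by omega) (by omega)
    have := hemono 1 (t + 2) (by omega) (by omega)
    unfold cyc; omega
  have b1' := Finset.sum_le_card_nsmul _ _ _ b1
  simp only [Finset.card_range, nsmul_eq_mul] at b1'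
  push_cast at b1'
  have hlt : ((t : ℝ) + 1) * Real.pi < (t + 3) * α := by
    linarith
  have hkt : (k : ℝ) + 1 ≤ t + 3 := by
    have : k + 1 ≤ t + 3 := by omega
    exact_mod_cast this
  have : (t + 3) * α ≤ ((t : ℝ) + 1) * Real.pi := by
    rw [hα, ← mul_assoc]
    refine mul_le_mul_of_nonneg_right ?_ Real.pi_pos.le
    have : 2 ≤ ((t : ℝ) + 3) * (2 / ((k : ℝ) + 1)) := by
      rw [mul_div_assoc', le_div_iff₀ (by linarith)]; linarith
    linarith
  linarith

/-! ### Extreme points, and the view from outside the chosen polygon. -/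

lemma plane_ext {a b : Plane} (h0 : a 0 = b 0) (h1 : a 1 = b 1) : a = b := by
  ext i; fin_cases i <;> assumption

/-- An extreme point that is a convex combination of three points with a positive weight on the
first one equals that point. -/
lemma eq_of_mem_extremePoints {K : Set Plane} (hK : Convex ℝ K) {x a b z : Plane}
    (hz : z ∈ K.extremePoints ℝ) (hx : x ∈ K) (ha : a ∈ K) (hb : b ∈ K) {r s t : ℝ} (hr : 0 < r)
    (hs : 0 ≤ s) (ht : 0 ≤ t) (hsum : r + s + t = 1) (he : r • x + s • a + t • b = z) : x = z := by
  rcases (add_nonneg hs ht).eq_or_lt with h | h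
  · have hs0 : s = 0 := by linarith
    have ht0 : t = 0 := by linarith
    have hr1 : r = 1 := by linarith
    rw [← he, hs0, ht0, hr1]; simp
  · refine hz.2 hx (hK ha hb (div_nonneg hs h.le) (div_nonneg ht h.le) (by field_simp))
      ⟨r, s + t, hr, h, by linarith, ?_⟩
    rw [← he, smul_add, smul_smul, smul_smul, mul_div_cancel₀ _ h.ne', mul_div_cancel₀ _ h.ne',
      add_assoc]

lemma barycentric {a b x z : Plane} (h : orient a x b ≠ 0) :
    (orient a z b / orient a x b) • x + (orient z x b / orient a x b) • a +
      (orient a x z / orient a x b) • b = z := by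
  have e : ∀ j, (orient a z b / orient a x b) * x j + (orient z x b / orient a x b) * a j +
      (orient a x z / orient a x b) * b j = z j := by
    intro j
    rw [div_mul_eq_mul_div, div_mul_eq_mul_div, div_mul_eq_mul_div, ← add_div, ← add_div,
      div_eq_iff h]
    unfold orient
    fin_cases j <;> (simp only [Fin.zero_eta, Fin.mk_one]; ring)
  exact plane_ext (by simpa using e 0) (by simpa using e 1)

lemma eq_of_mem_triangle {K : Set Plane} (hK : Convex ℝ K) {x a b z : Plane}
    (hz : z ∈ K.extremePoints ℝ) (hx : x ∈ K) (ha : a ∈ K) (hb : b ∈ K)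
    (h : 0 < orient a x b) (h1 : 0 < orient a z b) (h2 : 0 ≤ orient z x b)
    (h3 : 0 ≤ orient a x z) : x = z := by
  refine eq_of_mem_extremePoints hK hz hx ha hb (div_pos h1 h) (div_nonneg h2 h.le)
    (div_nonneg h3 h.le) ?_ (barycentric h.ne')
  rw [← add_div, ← add_div, div_eq_one_iff_eq h.ne']
  unfold orient; ring

/-- A point outside the convex hull of a finite set is strictly separated from it by a linear
functional. -/
lemma exists_separating {V : Set Plane} (hV : V.Finite) {x : Plane} (hx : x ∉ convexHull ℝ V) :
    ∃ c d : ℝ, ∀ v ∈ V, 0 < c * (v 0 - x 0) + d * (v 1 - x 1) := by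
  obtain ⟨f, u, h1, h2⟩ := geometric_hahn_banach_point_closed (convex_convexHull ℝ V)
    (hV.isClosed_convexHull ℝ) hx
  refine ⟨f !₂[1, 0], f !₂[0, 1], fun v hv => ?_⟩
  have h := h1.trans (h2 v (subset_convexHull ℝ V hv))
  have e : ∀ y : Plane, f y = f !₂[1, 0] * y 0 + f !₂[0, 1] * y 1 := by
    intro y
    have : y = y 0 • !₂[1, 0] + y 1 • (!₂[0, 1] : Plane) := plane_ext (by simp) (by simp)
    conv_lhs => rw [this]
    rw [map_add, map_smul, map_smul, smul_eq_mul, smul_eq_mul]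
    ring
  rw [e x, e v] at h
  linarith

/-- The slope of the ray from `x` to `v` with respect to the direction `(c, d)`. -/
def raySlope (c d : ℝ) (x v : Plane) : ℝ :=
  (c * (v 1 - x 1) - d * (v 0 - x 0)) / (c * (v 0 - x 0) + d * (v 1 - x 1))

lemma raySlope_lt_iff {c d : ℝ} {x v w : Plane} (hv : 0 < c * (v 0 - x 0) + d * (v 1 - x 1))
    (hw : 0 < c * (w 0 - x 0) + d * (w 1 - x 1)) :
    raySlope c d x v < raySlope c d x w ↔ 0 < orient x v w := by
  have hcd : 0 < c ^ 2 + d ^ 2 := by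
    refine lt_of_le_of_ne (by positivity) fun h => ?_
    have hc : c = 0 := by nlinarith [sq_nonneg c, sq_nonneg d]
    have hd : d = 0 := by nlinarith [sq_nonneg c, sq_nonneg d]
    rw [hc, hd] at hv; simp at hv
  unfold raySlope
  rw [div_lt_div_iff₀ hv hw, ← sub_pos, ← mul_pos_iff_of_pos_left (b := orient x v w) hcd]
  have : (c * (w 1 - x 1) - d * (w 0 - x 0)) * (c * (v 0 - x 0) + d * (v 1 - x 1)) -
      (c * (v 1 - x 1) - d * (v 0 - x 0)) * (c * (w 0 - x 0) + d * (w 1 - x 1)) =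
      (c ^ 2 + d ^ 2) * orient x v w := by
    unfold orient; ring
  rw [this]

lemma raySlope_le_iff {c d : ℝ} {x v w : Plane} (hv : 0 < c * (v 0 - x 0) + d * (v 1 - x 1))
    (hw : 0 < c * (w 0 - x 0) + d * (w 1 - x 1)) :
    raySlope c d x v ≤ raySlope c d x w ↔ 0 ≤ orient x v w := by
  rw [← not_lt, raySlope_lt_iff hw hv, not_lt]
  have : orient x w v = -orient x v w := by unfold orient; ring
  rw [this]
  constructor <;> intro h <;> linarith

lemma orient_swap (a b c : Plane) : orient c b a = -orient a b c := by unfold orient; ring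

/-- If `V` covers a polygon, then from every point of the polygon outside the convex hull of `V`,
some chord of `V` is seen under a wide angle. -/
theorem exists_wide_of_covers {p : ℕ → Plane} {τ : ℝ} {S V : Finset ℕ} (hS : ConvexSeq p S)
    (hext : ∀ i ∈ S, p i ∈ (convexHull ℝ (p '' S)).extremePoints ℝ) (hV : V ⊆ S)
    (hcard : 2 < V.card) (hcov : Covers p τ S V) {x : Plane} (hx : x ∈ convexHull ℝ (p '' S))
    (hxV : x ∉ convexHull ℝ (p '' V)) :
    ∃ a ∈ V, ∃ b ∈ V, 0 < orient (p a) x (p b) ∧ Wide τ (p a) x (p b) := by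
  set K := convexHull ℝ (p '' S) with hKdef
  have hK : Convex ℝ K := convex_convexHull ℝ _
  have hmem : ∀ i ∈ S, p i ∈ K := fun i hi => subset_convexHull ℝ _ ⟨i, hi, rfl⟩
  obtain ⟨c, d, hcd⟩ := exists_separating (V.finite_toSet.image p) hxV
  have hcd : ∀ v ∈ V, 0 < c * (p v 0 - x 0) + d * (p v 1 - x 1) :=
    fun v hv => hcd _ ⟨v, hv, rfl⟩
  have hVne : V.Nonempty := Finset.card_pos.1 (by omega)
  -- `a` and `b` span the extreme rays from `x`, between which all of `V` is seen.
  obtain ⟨a, ha, hamax⟩ := Finset.exists_max_image V (fun v => raySlope c d x (p v)) hVne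
  obtain ⟨b, hb, hbmin⟩ := Finset.exists_min_image V (fun v => raySlope c d x (p v)) hVne
  have hoa : ∀ v ∈ V, 0 ≤ orient (p a) x (p v) := fun v hv => by
    rw [← orient_rotate]; exact (raySlope_le_iff (hcd v hv) (hcd a ha)).1 (hamax v hv)
  have hob : ∀ v ∈ V, 0 ≤ orient (p v) x (p b) := fun v hv => by
    rw [← orient_rotate]; exact (raySlope_le_iff (hcd b hb) (hcd v hv)).1 (hbmin v hv)
  have hab : 0 < orient (p a) x (p b) := by
    rw [← orient_rotate, ← raySlope_lt_iff (hcd b hb) (hcd a ha)]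
    -- Otherwise all of `V` would lie on one line through `x`, impossible for three vertices in
    -- convex position.
    by_contra hle
    obtain ⟨i, j, l, hi, hj, hl, hij, hil, hjl⟩ := Finset.two_lt_card_iff.1 hcard
    have hz : ∀ v ∈ V, ∀ w ∈ V, orient x (p v) (p w) = 0 := by
      intro v hv w hw
      have h1 := (raySlope_le_iff (hcd v hv) (hcd w hw)).1
        ((hamax v hv).trans ((not_lt.1 hle).trans (hbmin w hw)))
      have h2 := (raySlope_le_iff (hcd w hw) (hcd v hv)).1
        ((hamax w hw).trans ((not_lt.1 hle).trans (hbmin v hv)))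
      have : orient x (p w) (p v) = -orient x (p v) (p w) := by unfold orient; ring
      linarith
    have key : ∀ i ∈ V, ∀ j ∈ V, ∀ l ∈ V, cyc i j l → False := by
      intro i hi j hj l hl h
      have h1 := hS.orient_pos (hV hi) (hV hj) (hV hl) h
      have : orient (p i) (p j) (p l) =
          orient x (p i) (p j) + orient x (p j) (p l) + orient x (p l) (p i) := by
        unfold orient; ring
      rw [hz i hi j hj, hz j hj l hl, hz l hl i hi] at this
      linarith
    have : cyc i j l ∨ cyc j i l := by unfold cyc; omega
    rcases this with h | h
    · exact key i hi j hj l hl h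
    · exact key j hj i hi l hl h
  refine ⟨a, ha, b, hb, hab, ?_⟩
  by_contra hwide
  unfold Wide at hwide
  rw [not_le] at hwide
  -- (g0, g1) is the gradient at `x` of `dotAt (p a) z (p b) - τ * orient (p a) z (p b)` as a
  -- function of `z`. That function is positive at `x` and zero at `p a` and `p b`; being a squared
  -- norm plus an affine function, it has negative linear part towards both.
  obtain ⟨g0, hg0⟩ : ∃ g : ℝ, g = 2 * x 0 - p a 0 - p b 0 - τ * (p b 1 - p a 1) := ⟨_, rfl⟩
  obtain ⟨g1, hg1⟩ : ∃ g : ℝ, g = 2 * x 1 - p a 1 - p b 1 + τ * (p b 0 - p a 0) := ⟨_, rfl⟩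
  have hexp : ∀ z : Plane, dotAt (p a) z (p b) - τ * orient (p a) z (p b) =
      dotAt (p a) x (p b) - τ * orient (p a) x (p b) + (g0 * (z 0 - x 0) + g1 * (z 1 - x 1)) +
        sqd z x := by
    intro z; rw [hg0, hg1]; unfold dotAt orient sqd; ring
  have hga : g0 * (p a 0 - x 0) + g1 * (p a 1 - x 1) < 0 := by
    have h := hexp (p a)
    have : dotAt (p a) (p a) (p b) - τ * orient (p a) (p a) (p b) = 0 := by
      unfold dotAt orient; ring
    linarith [sqd_nonneg (p a) x]
  have hgb : g0 * (p b 0 - x 0) + g1 * (p b 1 - x 1) < 0 := by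
    have h := hexp (p b)
    have : dotAt (p a) (p b) (p b) - τ * orient (p a) (p b) (p b) = 0 := by
      unfold dotAt orient; ring
    linarith [sqd_nonneg (p b) x]
  -- Since `x` is in the hull, some vertex lies on the nonnegative side; there the function is at
  -- least its value at `x`.
  obtain ⟨i, hi, hgi⟩ : ∃ i ∈ S, 0 ≤ g0 * (p i 0 - x 0) + g1 * (p i 1 - x 1) := by
    by_contra hno
    push Not at hno
    have hconv : Convex ℝ {z : Plane | g0 * (z 0 - x 0) + g1 * (z 1 - x 1) < 0} := by
      intro y hy z hz r s hr hs hrs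
      simp only [Set.mem_ofPred_eq, PiLp.add_apply, PiLp.smul_apply, smul_eq_mul] at *
      have e : g0 * (r * y 0 + s * z 0 - x 0) + g1 * (r * y 1 + s * z 1 - x 1) =
          r * (g0 * (y 0 - x 0) + g1 * (y 1 - x 1)) +
          s * (g0 * (z 0 - x 0) + g1 * (z 1 - x 1)) := by
        linear_combination (g0 * x 0 + g1 * x 1) * hrs
      rw [e]
      rcases hr.eq_or_lt with h | h
      · have : s = 1 := by linarith
        rw [← h, this]; linarith
      · have := mul_neg_of_pos_of_neg h hy
        have := mul_nonpos_of_nonneg_of_nonpos hs hz.le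
        linarith
    have : x ∈ {z : Plane | g0 * (z 0 - x 0) + g1 * (z 1 - x 1) < 0} :=
      convexHull_min (by rintro _ ⟨i, hi, rfl⟩; exact hno i hi) hconv hx
    simp at this
  have hnw : ¬ Wide τ (p a) (p i) (p b) := by
    unfold Wide
    rw [not_le]
    linarith [hexp (p i), sqd_nonneg (p i) x]
  have hia : i ≠ a := by rintro rfl; linarith
  have hib : i ≠ b := by rintro rfl; linarith
  have hne : a ≠ b := by
    rintro rfl
    unfold orient at hab; linarith
  have hcases : cyc a i b ∨ cyc b i a := by unfold cyc; omega
  rcases hcases with hc | hc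
  -- A vertex of `V` between `a` and `b` would lie in the triangle `a x b` and so equal `x` by
  -- extremality. Hence `a` and `b` are consecutive in `V`.
  · refine hnw (hcov a ha b hb (fun v hv hvc => ?_) i hi hc)
    refine hxV ?_
    rw [eq_of_mem_triangle hK (hext v (hV hv)) hx (hmem a (hV ha)) (hmem b (hV hb)) hab
      (hS.orient_pos (hV ha) (hV hv) (hV hb) hvc) (hob v hv) (hoa v hv)]
    exact subset_convexHull ℝ _ ⟨v, hv, rfl⟩
  -- Now `i` is across the line `a b` from `x`, and the segment from `x` to `p i` meets that line at
  -- `y`. If `y` lies beyond `p a` or `p b`, that vertex is not extreme; if between them, the linear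
  -- form is negative at `y`, contrary to `hgy`.
  · have ho := hS.orient_pos (hV hb) hi (hV ha) hc
    rw [orient_swap] at ho
    obtain ⟨t, ht⟩ : ∃ t, t = orient (p a) x (p b) /
      (orient (p a) x (p b) - orient (p a) (p i) (p b)) := ⟨_, rfl⟩
    have hden : 0 < orient (p a) x (p b) - orient (p a) (p i) (p b) := by linarith
    have ht0 : 0 < t := by rw [ht]; exact div_pos hab hden
    have ht1 : t < 1 := by rw [ht, div_lt_one hden]; linarith
    have hte : t * (orient (p a) x (p b) - orient (p a) (p i) (p b)) = orient (p a) x (p b) := by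
      rw [ht, div_mul_cancel₀ _ hden.ne']
    obtain ⟨y, hy⟩ : ∃ y : Plane, y = (1 - t) • x + t • p i := ⟨_, rfl⟩
    have hyK : y ∈ K := by
      rw [hy]; exact hK hx (hmem i hi) (by linarith) ht0.le (by ring)
    have hy0 : y 0 = (1 - t) * x 0 + t * p i 0 := by rw [hy]; simp
    have hy1 : y 1 = (1 - t) * x 1 + t * p i 1 := by rw [hy]; simp
    have hyo : orient (p a) y (p b) = 0 := by
      have : orient (p a) y (p b) =
          (1 - t) * orient (p a) x (p b) + t * orient (p a) (p i) (p b) := by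
        unfold orient; rw [hy0, hy1]; ring
      linarith
    have hgy : 0 ≤ g0 * (y 0 - x 0) + g1 * (y 1 - x 1) := by
      rw [hy0, hy1]
      have := mul_nonneg ht0.le hgi
      linarith
    have hsq : 0 < sqd (p a) (p b) := sqd_pos_of_orient hab
    obtain ⟨s, hs⟩ : ∃ s, s = dotAt y (p a) (p b) / sqd (p a) (p b) := ⟨_, rfl⟩
    have hse : s * sqd (p a) (p b) = dotAt y (p a) (p b) := by
      rw [hs, div_mul_cancel₀ _ hsq.ne']
    have hyab0 : y 0 = (1 - s) * p a 0 + s * p b 0 := by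
      have : sqd (p a) (p b) * y 0 = sqd (p a) (p b) * ((1 - s) * p a 0 + s * p b 0) := by
        unfold sqd dotAt orient at *
        linear_combination (p a 0 - p b 0) * hse + (p b 1 - p a 1) * hyo
      exact mul_left_cancel₀ hsq.ne' this
    have hyab1 : y 1 = (1 - s) * p a 1 + s * p b 1 := by
      have : sqd (p a) (p b) * y 1 = sqd (p a) (p b) * ((1 - s) * p a 1 + s * p b 1) := by
        unfold sqd dotAt orient at *
        linear_combination (p a 1 - p b 1) * hse - (p b 0 - p a 0) * hyo
      exact mul_left_cancel₀ hsq.ne' this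
    have hpne : p a ≠ p b := by
      intro h; rw [h] at hsq; unfold sqd at hsq; linarith
    rcases lt_or_ge s 0 with h | h
    · have h1s : 0 < 1 - s := by linarith
      have := eq_of_mem_extremePoints hK (hext a (hV ha)) (hmem b (hV hb)) hyK hyK
        (r := -s / (1 - s)) (s := 1 / (1 - s)) (t := 0) (div_pos (by linarith) h1s)
        (by positivity) le_rfl (by field_simp; ring) (by
          apply plane_ext <;> simp only [PiLp.add_apply, PiLp.smul_apply, smul_eq_mul]
          · rw [hyab0]; field_simp; ring
          · rw [hyab1]; field_simp; ring)
      exact hpne this.symm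
    rcases lt_or_ge 1 s with h' | h'
    · have h1s : 0 < s := by linarith
      have := eq_of_mem_extremePoints hK (hext b (hV hb)) (hmem a (hV ha)) hyK hyK
        (r := (s - 1) / s) (s := 1 / s) (t := 0) (div_pos (by linarith) h1s)
        (by positivity) le_rfl (by field_simp; ring) (by
          apply plane_ext <;> simp only [PiLp.add_apply, PiLp.smul_apply, smul_eq_mul]
          · rw [hyab0]; field_simp; ring
          · rw [hyab1]; field_simp; ring)
      exact hpne this
    · have e : g0 * (y 0 - x 0) + g1 * (y 1 - x 1) =
          (1 - s) * (g0 * (p a 0 - x 0) + g1 * (p a 1 - x 1)) +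
          s * (g0 * (p b 0 - x 0) + g1 * (p b 1 - x 1)) := by
        rw [hyab0, hyab1]; ring
      rcases h.eq_or_lt with h0 | h0
      · rw [← h0] at e; linarith
      · have := mul_neg_of_pos_of_neg h0 hgb
        have := mul_nonpos_of_nonneg_of_nonpos (by linarith : 0 ≤ 1 - s) hga.le
        linarith

/-! ### Counterclockwise enumeration of the vertices. -/

lemma exists_sorted {β : Type*} [Nonempty β] (F : Finset β) (s : β → ℝ) (hs : Set.InjOn s F) :
    ∃ p : ℕ → β, p '' Finset.range F.card = F ∧
      ∀ i j, i < j → j < F.card → s (p i) < s (p j) := by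
  classical
  have hcard : (F.image s).card = F.card := Finset.card_image_of_injOn hs
  let f := (F.image s).orderEmbOfFin hcard
  have hf : ∀ j, ∃ q ∈ F, s q = f j := fun j => by
    have := Finset.orderEmbOfFin_mem (F.image s) hcard j
    exact Finset.mem_image.1 this
  choose q hq hsq using hf
  let p : ℕ → β := fun j => if h : j < F.card then q ⟨j, h⟩ else Classical.arbitrary β
  have hp : ∀ j (h : j < F.card), p j = q ⟨j, h⟩ := fun j h => by simp [p, h]
  refine ⟨p, ?_, fun i j hij hj => ?_⟩
  · ext z
    constructor
    · rintro ⟨j, hj, rfl⟩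
      have hj : j < F.card := by simpa using hj
      rw [hp j hj]
      exact hq _
    · intro hz
      have : s z ∈ Set.range f := by
        rw [Finset.range_orderEmbOfFin]
        exact Finset.mem_coe.2 (Finset.mem_image_of_mem s hz)
      obtain ⟨⟨j, hj⟩, h⟩ := this
      refine ⟨j, by simpa using hj, hs (by rw [hp j hj]; exact hq _) hz ?_⟩
      rw [hp j hj, hsq, h]
  · rw [hp i (by omega), hp j hj, hsq, hsq]
    exact f.lt_iff_lt.2 hij

/-- The vertices of a convex polygon in counterclockwise order. -/
theorem exists_convexSeq (E : Finset Plane) (hne : E.Nonempty)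
    (hext : ∀ e ∈ E, e ∈ (convexHull ℝ (E : Set Plane)).extremePoints ℝ) :
    ∃ p : ℕ → Plane, p '' Finset.range E.card = E ∧ ConvexSeq p (Finset.range E.card) := by
  classical
  set K := convexHull ℝ (E : Set Plane) with hKdef
  have hK : Convex ℝ K := convex_convexHull ℝ _
  have hmem : ∀ e ∈ E, e ∈ K := fun e he => subset_convexHull ℝ _ he
  obtain ⟨e, he⟩ := hne
  have hnot : e ∉ convexHull ℝ ((E.erase e : Finset Plane) : Set Plane) := by
    intro h
    have h1 : e ∈ (convexHull ℝ ((E.erase e : Finset Plane) : Set Plane)).extremePoints ℝ :=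
      inter_extremePoints_subset_extremePoints_of_subset
        (convexHull_mono (Finset.coe_subset.2 (Finset.erase_subset _ _))) ⟨h, hext e he⟩
    have := extremePoints_convexHull_subset h1
    simp at this
  obtain ⟨c, d, hcd⟩ := exists_separating (Finset.finite_toSet _) hnot
  have hcd : ∀ v ∈ E.erase e, 0 < c * (v 0 - e 0) + d * (v 1 - e 1) := hcd
  have hinj : Set.InjOn (raySlope c d e) (E.erase e : Finset Plane) := by
    intro v hv w hw h
    have hv' := hcd v hv
    have hw' := hcd w hw
    have o1 := (raySlope_le_iff hv' hw').1 h.le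
    have o2 := (raySlope_le_iff hw' hv').1 h.ge
    have o : orient e v w = 0 := by
      have : orient e w v = -orient e v w := by unfold orient; ring
      linarith
    -- Of two vertices on one ray from `e`, the nearer is a convex combination of the farther and
    -- `e`, against extremality.
    have main : ∀ v ∈ E.erase e, ∀ w ∈ E.erase e, orient e v w = 0 →
        c * (v 0 - e 0) + d * (v 1 - e 1) ≤ c * (w 0 - e 0) + d * (w 1 - e 1) → w = v := by
      intro v hv w hw o hle
      have hv' := hcd v hv
      have hw' := hcd w hw
      have hv := Finset.mem_of_mem_erase hv
      have hw := Finset.mem_of_mem_erase hw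
      obtain ⟨x, hx⟩ : ∃ x, x = c * (v 0 - e 0) + d * (v 1 - e 1) := ⟨_, rfl⟩
      obtain ⟨y, hy⟩ : ∃ x, x = c * (w 0 - e 0) + d * (w 1 - e 1) := ⟨_, rfl⟩
      have hy0 : 0 < y := by rw [hy]; exact hw'
      have hx0 : 0 < x := by rw [hx]; exact hv'
      have hxy : x ≤ y := by rw [hx, hy]; exact hle
      refine eq_of_mem_extremePoints hK (hext v hv) (hmem w hw) (hmem e he) (hmem e he)
        (r := x / y) (s := 1 - x / y) (t := 0) (div_pos hx0 hy0)
        (by rw [sub_nonneg, div_le_one hy0]; exact hxy) le_rfl (by ring) ?_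
      unfold orient at o
      apply plane_ext <;> simp only [PiLp.add_apply, PiLp.smul_apply, smul_eq_mul] <;> field_simp
      · rw [hx, hy]; linear_combination (-d) * o
      · rw [hx, hy]; linear_combination c * o
    rcases le_total (c * (v 0 - e 0) + d * (v 1 - e 1)) (c * (w 0 - e 0) + d * (w 1 - e 1))
      with hle | hle
    · exact (main v hv w hw o hle).symm
    · refine main w hw v hv ?_ hle
      have : orient e w v = -orient e v w := by unfold orient; ring
      rw [this, o, neg_zero]
  obtain ⟨q, hq, hlt⟩ := exists_sorted (E.erase e) (raySlope c d e) hinj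
  have hcard : E.card = (E.erase e).card + 1 := (Finset.card_erase_add_one he).symm
  have hqmem : ∀ j, j < (E.erase e).card → q j ∈ E.erase e := fun j hj => by
    have : q j ∈ q '' Finset.range (E.erase e).card := ⟨j, by simpa using hj, rfl⟩
    rw [hq] at this
    exact this
  have hor : ∀ i j, i < j → j < (E.erase e).card → 0 < orient e (q i) (q j) := fun i j hij hj =>
    (raySlope_lt_iff (hcd _ (hqmem i (by omega))) (hcd _ (hqmem j hj))).1 (hlt i j hij hj)
  let p : ℕ → Plane := fun j => Nat.casesOn j e q
  refine ⟨p, ?_, ?_⟩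
  · ext z
    constructor
    · rintro ⟨j, hj, rfl⟩
      have hj : j < E.card := by simpa using hj
      cases j with
      | zero => exact he
      | succ j => exact Finset.mem_of_mem_erase (hqmem j (by omega))
    · intro hz
      by_cases hze : z = e
      · exact ⟨0, by simp [hcard], hze.symm⟩
      · have : z ∈ q '' Finset.range (E.erase e).card := by
          rw [hq]; exact Finset.mem_coe.2 (Finset.mem_erase.2 ⟨hze, hz⟩)
        obtain ⟨j, hj, rfl⟩ := this
        exact ⟨j + 1, by simpa [hcard] using hj, rfl⟩
  · intro i _ j _ l hl hij hjl
    have hl : l < E.card := by simpa using hl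
    obtain ⟨j, rfl⟩ : ∃ j', j = j' + 1 := ⟨j - 1, by omega⟩
    obtain ⟨l, rfl⟩ : ∃ l', l = l' + 1 := ⟨l - 1, by omega⟩
    cases i with
    | zero => exact hor j l (by omega) (by omega)
    | succ i =>
      change 0 < orient (q i) (q j) (q l)
      by_contra hle
      have o1 := hor i j (by omega) (by omega)
      have o2 := hor j l (by omega) (by omega)
      have o3 := hor i l (by omega) (by omega)
      have hqE : ∀ j, j < (E.erase e).card → q j ∈ E := fun j hj =>
        Finset.mem_of_mem_erase (hqmem j hj)
      -- A wrong orientation would put `q j` in the triangle `e`, `q i`, `q l` with positive weight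
      -- on `q i`.
      have heq := eq_of_mem_triangle hK (x := q i) (a := e) (b := q l) (z := q j)
        (hext _ (hqE j (by omega))) (hmem _ (hqE i (by omega))) (hmem _ he)
        (hmem _ (hqE l (by omega))) o3 o2
        (by
          have : orient (q j) (q i) (q l) = -orient (q i) (q j) (q l) := by unfold orient; ring
          linarith) o1.le
      rw [heq] at o1
      unfold orient at o1
      linarith

/-! ### Aperture bounds as a closed condition. -/

open scoped RealInnerProductSpace

/-- No open cone with apex `x` and half-angle `arccos c` contains `Q`. -/
def Sees (c : ℝ) (x : Plane) (Q : Set Plane) : Prop :=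
  ∀ u : Plane, ∃ y ∈ Q, ⟪y - x, u⟫ ≤ c * (‖y - x‖ * ‖u‖)

lemma Sees.mono {c : ℝ} {x : Plane} {Q R : Set Plane} (h : Sees c x Q) (hQR : Q ⊆ R) :
    Sees c x R := fun u => by
  obtain ⟨y, hy, hu⟩ := h u
  exact ⟨y, hQR hy, hu⟩

/-- As `c ≥ 0`, violation by `u` would put `V` in an open half-plane with `x` on its boundary, which
no hull point allows. -/
lemma sees_of_mem_convexHull {c : ℝ} (hc : 0 ≤ c) {x : Plane} {V : Set Plane}
    (hx : x ∈ convexHull ℝ V) : Sees c x V := by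
  intro u
  by_contra! h
  have hlin : IsLinearMap ℝ (fun y : Plane => ⟪y, u⟫) :=
    ⟨fun a b => inner_add_left _ _ _, fun r a => by simp [real_inner_smul_left]⟩
  have hsub : V ⊆ {y : Plane | ⟪x, u⟫ < ⟪y, u⟫} := fun y hy => by
    have h1 := h y hy
    rw [inner_sub_left] at h1
    have : 0 ≤ c * (‖y - x‖ * ‖u‖) := by positivity
    change ⟪x, u⟫ < ⟪y, u⟫
    linarith
  have := convexHull_min hsub (convex_halfSpace_gt hlin _) hx
  exact lt_irrefl ⟪x, u⟫ this

/-- By the triangle inequality for angles, any axis makes an angle of at least α/2 with one of the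
rays to `a` and `b`. -/
lemma sees_of_le_angle {α : ℝ} (h0 : 0 ≤ α) {x a b : Plane} {V : Set Plane}
    (ha : a ∈ V) (hb : b ∈ V) (h : α ≤ ∠ a x b) : Sees (Real.cos (α / 2)) x V := by
  intro u
  have key : ∀ y : Plane, α / 2 ≤ InnerProductGeometry.angle (y - x) u →
      ⟪y - x, u⟫ ≤ Real.cos (α / 2) * (‖y - x‖ * ‖u‖) := fun y hy => by
    rw [← InnerProductGeometry.cos_angle_mul_norm_mul_norm]
    refine mul_le_mul_of_nonneg_right ?_ (by positivity)
    exact Real.cos_le_cos_of_nonneg_of_le_pi (by linarith)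
      (InnerProductGeometry.angle_le_pi _ _) hy
  have h1 := InnerProductGeometry.angle_le_angle_add_angle (a - x) u (b - x)
  have h2 : ∠ a x b = InnerProductGeometry.angle (a - x) (b - x) := rfl
  rw [InnerProductGeometry.angle_comm u] at h1
  by_cases h3 : α / 2 ≤ InnerProductGeometry.angle (a - x) u
  · exact ⟨a, ha, key a h3⟩
  · exact ⟨b, hb, key b (by linarith)⟩

lemma le_apertureAngle_of_sees {α : ℝ} (h1 : α ≤ Real.pi) {x : Plane} {Q : Set Plane}
    (h : Sees (Real.cos (α / 2)) x Q) : α ≤ apertureAngle x Q := by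
  unfold apertureAngle
  split_ifs with hx
  · exact h1
  have hpi := Real.pi_pos
  refine le_csInf ⟨2 * Real.pi, ⟨by positivity, le_rfl⟩, EuclideanSpace.single 0 1, ?_, ?_⟩ ?_
  · intro h
    have := congrArg (fun z : Plane => z 0) h
    simp at this
  · intro y _
    right
    have := InnerProductGeometry.angle_le_pi (y - x) (EuclideanSpace.single 0 1)
    linarith
  · rintro θ ⟨⟨hθ0, -⟩, u, hu, hQ⟩
    by_contra! hlt
    obtain ⟨y, hy, hyu⟩ := h u
    have hyx : y ≠ x := fun e => hx (e ▸ hy)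
    have hang := (hQ hy).resolve_left hyx
    rw [← InnerProductGeometry.cos_angle_mul_norm_mul_norm] at hyu
    have hpos : 0 < ‖y - x‖ * ‖u‖ :=
      mul_pos (norm_pos_iff.2 (sub_ne_zero.2 hyx)) (norm_pos_iff.2 hu)
    have := le_of_mul_le_mul_right hyu hpos
    have h3 := Real.cos_lt_cos_of_nonneg_of_le_pi
      (InnerProductGeometry.angle_nonneg (y - x) u) (by linarith : α / 2 ≤ Real.pi)
      (by linarith)
    linarith

lemma exists_extreme_finset (S : Finset Plane) :
    ∃ E ⊆ S, (E : Set Plane) = (convexHull ℝ (S : Set Plane)).extremePoints ℝ ∧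
      convexHull ℝ (E : Set Plane) = convexHull ℝ (S : Set Plane) := by
  classical
  have hsub : (convexHull ℝ (S : Set Plane)).extremePoints ℝ ⊆ S := extremePoints_convexHull_subset
  have hfin := S.finite_toSet.subset hsub
  refine ⟨hfin.toFinset, fun x hx => hsub (by simpa using hx), by simp, ?_⟩
  rw [hfin.coe_toFinset]
  have := closure_convexHull_extremePoints (S.finite_toSet.isCompact_convexHull (𝕜 := ℝ))
    (convex_convexHull ℝ (S : Set Plane))
  rwa [(hfin.isClosed_convexHull (𝕜 := ℝ)).closure_eq] at this

/-! ### The constant α_k and the lower bound for finite sets. -/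

/-- The angle bound for regular polygons, as a constant. -/
def optimalAngle (k : ℕ) : ℝ := (1 - 2 / ((k : ℝ) + 1)) * Real.pi

lemma half_pi_le_optimalAngle {k : ℕ} (hk : 2 < k) : Real.pi / 2 ≤ optimalAngle k := by
  have h : (3 : ℝ) ≤ k := by exact_mod_cast hk
  have : 2 / ((k : ℝ) + 1) ≤ 1 / 2 := by
    rw [div_le_div_iff₀ (by linarith) (by norm_num)]
    linarith
  unfold optimalAngle
  nlinarith [Real.pi_pos]

lemma optimalAngle_lt_pi (k : ℕ) : optimalAngle k < Real.pi := by
  have : 0 < 2 / ((k : ℝ) + 1) := by positivity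
  unfold optimalAngle
  nlinarith [Real.pi_pos]

lemma optimalAngle_pos {k : ℕ} (hk : 2 < k) : 0 < optimalAngle k :=
  (half_pos Real.pi_pos).trans_le (half_pi_le_optimalAngle hk)

lemma cot_optimalAngle_nonpos {k : ℕ} (hk : 2 < k) : Real.cot (optimalAngle k) ≤ 0 := by
  rw [Real.cot_eq_cos_div_sin]
  have h1 := half_pi_le_optimalAngle hk
  have h2 := optimalAngle_lt_pi k
  have := Real.pi_pos
  refine div_nonpos_of_nonpos_of_nonneg (Real.cos_nonpos_of_pi_div_two_le_of_le h1 (by linarith))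
    (Real.sin_nonneg_of_nonneg_of_le_pi (by linarith) h2.le)

lemma cos_half_optimalAngle_nonneg {k : ℕ} (hk : 2 < k) : 0 ≤ Real.cos (optimalAngle k / 2) := by
  have h1 := optimalAngle_pos hk
  have h2 := optimalAngle_lt_pi k
  exact Real.cos_nonneg_of_neg_pi_div_two_le_of_le (by linarith) (by linarith)

/-- The finite version of the lower bound. -/
lemma exists_finset_sees {k : ℕ} (hk : 2 < k) (S : Finset Plane) (hS : S.Nonempty) :
    ∃ V ⊆ S, V.Nonempty ∧ V.card ≤ k ∧ ∀ x ∈ convexHull ℝ (S : Set Plane),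
      Sees (Real.cos (optimalAngle k / 2)) x V := by
  classical
  obtain ⟨E, hES, hext, hconv⟩ := exists_extreme_finset S
  have hEne : E.Nonempty := by
    rw [← Finset.coe_nonempty, ← convexHull_nonempty_iff (𝕜 := ℝ), hconv]
    exact (Finset.coe_nonempty.2 hS).convexHull
  have hc := cos_half_optimalAngle_nonneg hk
  rcases le_or_gt E.card k with hle | hlt
  · exact ⟨E, hES, hEne, hle, fun x hx => sees_of_mem_convexHull hc (by rwa [hconv])⟩
  rw [← hconv] at hext
  obtain ⟨p, hp, hseq⟩ := exists_convexSeq E hEne fun e he => by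
    rw [← hext]; exact he
  obtain ⟨n, hn⟩ := Nat.exists_eq_add_of_le hlt.le
  obtain ⟨V, hVS, hVc, hcov⟩ := exists_covers (cot_optimalAngle_nonpos hk) (k := k) n
    (Finset.range E.card) (by simpa using hn) hseq
    fun T hT hTc => exists_isEar (by omega) (hseq.mono hT) hTc
  have hVE : V.image p ⊆ E := fun y hy => by
    obtain ⟨i, hi, rfl⟩ := Finset.mem_image.1 hy
    have : p i ∈ p '' (Finset.range E.card) := ⟨i, hVS hi, rfl⟩
    rw [hp] at this
    exact this
  have hVne : V.Nonempty := Finset.card_pos.1 (by omega)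
  refine ⟨V.image p, hVE.trans hES, hVne.image p, Finset.card_image_le.trans hVc.le, ?_⟩
  intro x hx
  rw [← hconv] at hx
  by_cases hxV : x ∈ convexHull ℝ ((V.image p : Finset Plane) : Set Plane)
  · exact sees_of_mem_convexHull hc hxV
  obtain ⟨a, ha, b, hb, hpos, hw⟩ := exists_wide_of_covers hseq
    (fun i hi => by
      rw [hp, ← hext, ← hp]
      exact ⟨i, hi, rfl⟩) hVS (by omega) hcov (by rwa [hp]) (by simpa using hxV)
  rw [wide_iff_le_angle (optimalAngle_pos hk) (optimalAngle_lt_pi k) hpos] at hw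
  exact sees_of_le_angle (optimalAngle_pos hk).le (Finset.mem_coe.2 (Finset.mem_image_of_mem p ha))
    (Finset.mem_coe.2 (Finset.mem_image_of_mem p hb)) hw

/-! ### Passage to compact sets. -/

lemma exists_fin_range_eq {β : Type*} {k : ℕ} (V : Finset β) (hV : V.Nonempty) (hk : V.card ≤ k) :
    ∃ v : Fin k → β, Set.range v = V := by
  obtain ⟨f⟩ := Function.Embedding.nonempty_of_card_le (α := V) (β := Fin k) (by simpa using hk)
  have : Nonempty V := hV.to_subtype
  refine ⟨fun i => (Function.invFun f i : V), ?_⟩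
  rw [show (fun i => ((Function.invFun f i : V) : β)) = Subtype.val ∘ Function.invFun f from rfl,
    Set.range_comp, (Function.invFun_surjective f.injective).range_eq]
  simp

/-- For fixed `x`, the tuples satisfying `Sees` form a closed set, a finite union over the index for
each direction `u`. The finite case supplies the finite intersection property on the compact set
C^k. -/
lemma exists_tuple_sees {k : ℕ} (hk : 2 < k) {C : Set Plane} (hC : IsCompact C)
    (hne : C.Nonempty) :
    ∃ v : Fin k → Plane, (∀ i, v i ∈ C) ∧
      ∀ x ∈ C, Sees (Real.cos (optimalAngle k / 2)) x (Set.range v) := by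
  classical
  obtain ⟨x₀, hx₀⟩ := hne
  let Z : C → Set (Fin k → Plane) := fun x =>
    {v | Sees (Real.cos (optimalAngle k / 2)) x (Set.range v)}
  have hZ : ∀ x, IsClosed (Z x) := fun x => by
    have : Z x = ⋂ u : Plane, ⋃ i : Fin k,
        {v | ⟪v i - (x : Plane), u⟫ ≤
          Real.cos (optimalAngle k / 2) * (‖v i - (x : Plane)‖ * ‖u‖)} := by
      ext v
      simp [Z, Sees]
    rw [this]
    refine isClosed_iInter fun u => isClosed_iUnion_of_finite fun i => ?_
    exact isClosed_le (by fun_prop) (by fun_prop)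
  obtain ⟨v, hvC, hv⟩ := (isCompact_univ_pi fun _ : Fin k => hC).inter_iInter_nonempty Z hZ
    fun t => by
      -- `x₀` keeps `S` nonempty when `t` is empty.
      let S : Finset Plane := insert x₀ (t.image Subtype.val)
      obtain ⟨V, hVS, hVne, hVk, hsee⟩ := exists_finset_sees hk S (Finset.insert_nonempty _ _)
      obtain ⟨v, hv⟩ := exists_fin_range_eq V hVne hVk
      have hSC : ∀ y ∈ S, y ∈ C := fun y hy => by
        rcases Finset.mem_insert.1 hy with rfl | hy
        · exact hx₀
        · obtain ⟨z, -, rfl⟩ := Finset.mem_image.1 hy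
          exact z.2
      refine ⟨v, fun i _ => hSC _ (hVS ?_), ?_⟩
      · rw [← Finset.mem_coe, ← hv]
        exact ⟨i, rfl⟩
      · simp only [Set.mem_iInter]
        intro x hx
        change Sees _ _ _
        rw [hv]
        exact hsee _ (subset_convexHull ℝ _ (Finset.mem_coe.2
          (Finset.mem_insert_of_mem (Finset.mem_image_of_mem _ hx))))
  refine ⟨v, fun i => hvC i trivial, fun x hx => ?_⟩
  exact Set.mem_iInter.1 hv ⟨x, hx⟩

/-! ### Polygons with nonempty interior. -/

lemma affineSpan_eq_top_of_orient {V : Set Plane} {a b c : Plane} (ha : a ∈ V) (hb : b ∈ V)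
    (hc : c ∈ V) (h : orient a b c ≠ 0) : affineSpan ℝ V = ⊤ := by
  rw [eq_top_iff]
  intro y _
  have hdir : ∀ z ∈ V, z - a ∈ (affineSpan ℝ V).direction := fun z hz => by
    rw [← vsub_eq_sub]
    exact AffineSubspace.vsub_mem_direction (subset_affineSpan ℝ _ hz) (subset_affineSpan ℝ _ ha)
  have hy : y = ((orient a y c / orient a b c) • (b - a) +
      (orient a b y / orient a b c) • (c - a)) +ᵥ a := by
    apply plane_ext <;>
    · simp [vadd_eq_add]
      field_simp
      simp only [orient]
      ring
  rw [hy]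
  exact AffineSubspace.vadd_mem_of_mem_direction
    (add_mem (Submodule.smul_mem _ _ (hdir b hb)) (Submodule.smul_mem _ _ (hdir c hc)))
    (subset_affineSpan ℝ _ ha)

lemma exists_pos_add_smul_mem {C : Set Plane} {x : Plane} (hx : x ∈ interior C) (w : Plane) :
    ∃ ε : ℝ, 0 < ε ∧ x + ε • w ∈ C := by
  have hcont : ContinuousAt (fun ε : ℝ => x + ε • w) 0 := by fun_prop
  have hmem : C ∈ nhds (x + (0 : ℝ) • w) := by
    simpa using mem_interior_iff_mem_nhds.1 hx
  have := (hcont.eventually hmem).filter_mono (nhdsWithin_le_nhds (s := Set.Ioi 0))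
  obtain ⟨ε, h1, h2⟩ := (this.and self_mem_nhdsWithin).exists
  exact ⟨ε, h2, h1⟩

lemma exists_ne_mem {C : Set Plane} (hC : (interior C).Nonempty) (a : Plane) :
    ∃ b ∈ C, b ≠ a := by
  obtain ⟨x, hx⟩ := hC
  by_cases hxa : x = a
  · obtain ⟨ε, hε, h⟩ := exists_pos_add_smul_mem hx (EuclideanSpace.single 0 1)
    refine ⟨_, h, fun e => ?_⟩
    rw [hxa] at e
    have := congrArg (fun z : Plane => z 0) e
    simp at this
    exact hε.ne' this
  · exact ⟨x, interior_subset hx, hxa⟩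

lemma sqd_pos_of_ne {a b : Plane} (h : a ≠ b) : 0 < sqd a b := by
  refine lt_of_le_of_ne (sqd_nonneg a b) fun e => h ?_
  have e' : (a 0 - b 0) ^ 2 + (a 1 - b 1) ^ 2 = 0 := e.symm
  apply plane_ext <;> nlinarith [sq_nonneg (a 0 - b 0), sq_nonneg (a 1 - b 1)]

lemma exists_orient_ne_zero {C : Set Plane} (hC : (interior C).Nonempty) {a b : Plane}
    (hab : a ≠ b) : ∃ c ∈ C, orient a b c ≠ 0 := by
  obtain ⟨x, hx⟩ := hC
  by_cases h : orient a b x = 0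
  · obtain ⟨ε, hε, h'⟩ := exists_pos_add_smul_mem hx !₂[-(b 1 - a 1), b 0 - a 0]
    refine ⟨_, h', ?_⟩
    have : orient a b (x + ε • !₂[-(b 1 - a 1), b 0 - a 0]) = orient a b x + ε * sqd a b := by
      simp [orient, sqd]
      ring
    rw [this, h, zero_add]
    exact (mul_pos hε (sqd_pos_of_ne hab)).ne'
  · exact ⟨x, interior_subset hx, h⟩

lemma mem_segment_of_orient_eq_zero {a b v : Plane} (h : orient a b v = 0)
    (ha : sqd a v ≤ sqd a b) (hb : sqd v b ≤ sqd a b) : v ∈ segment ℝ a b := by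
  by_cases hab : a = b
  · subst hab
    by_cases hv : a = v
    · subst hv; exact left_mem_segment ℝ _ _
    · have := sqd_pos_of_ne hv
      have h0 : sqd a a = 0 := by simp [sqd]
      linarith
  have hpos := sqd_pos_of_ne hab
  obtain ⟨t, ht⟩ : ∃ t, t = dotAt v a b / sqd a b := ⟨_, rfl⟩
  have hv : v = a + t • (b - a) := by
    subst ht
    have hd := hpos.ne'
    simp only [orient] at h
    apply plane_ext
    · simp only [PiLp.add_apply, PiLp.smul_apply, PiLp.sub_apply, smul_eq_mul]
      rw [← sub_eq_iff_eq_add', div_mul_eq_mul_div, eq_div_iff hd]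
      simp only [sqd, dotAt]
      linear_combination (-(b 1 - a 1)) * h
    · simp only [PiLp.add_apply, PiLp.smul_apply, PiLp.sub_apply, smul_eq_mul]
      rw [← sub_eq_iff_eq_add', div_mul_eq_mul_div, eq_div_iff hd]
      simp only [sqd, dotAt]
      linear_combination (b 0 - a 0) * h
  have h1 : sqd a v = t ^ 2 * sqd a b := by rw [hv]; simp [sqd]; ring
  have h2 : sqd v b = (1 - t) ^ 2 * sqd a b := by rw [hv]; simp [sqd]; ring
  have h3 : t ^ 2 ≤ 1 := by nlinarith
  have h4 : (1 - t) ^ 2 ≤ 1 := by nlinarith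
  rw [segment_eq_image']
  exact ⟨t, ⟨by nlinarith, by nlinarith⟩, hv.symm⟩

/-- A collinear `V` lies in the segment joining a farthest pair. If that pair coincides, another
point of `C` replaces one end; a point of `C` off the line completes the triangle. -/
lemma exists_nondegenerate_triangle {C : Set Plane} (hC : (interior C).Nonempty) {V : Finset Plane}
    (hV : V.Nonempty) (hVC : (V : Set Plane) ⊆ C)
    (hdeg : ∀ a ∈ V, ∀ b ∈ V, ∀ c ∈ V, orient a b c = 0) :
    ∃ a ∈ C, ∃ b ∈ C, ∃ c ∈ C, orient a b c ≠ 0 ∧ (V : Set Plane) ⊆ convexHull ℝ {a, b, c} := by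
  obtain ⟨⟨a, b⟩, hab, hmax⟩ := (V ×ˢ V).exists_max_image (fun q => sqd q.1 q.2) (hV.product hV)
  obtain ⟨ha, hb⟩ := Finset.mem_product.1 hab
  have hseg : ∀ v ∈ V, v ∈ segment ℝ a b := fun v hv =>
    mem_segment_of_orient_eq_zero (hdeg a ha b hb v hv)
      (hmax (a, v) (Finset.mem_product.2 ⟨ha, hv⟩)) (hmax (v, b) (Finset.mem_product.2 ⟨hv, hb⟩))
  obtain ⟨b', hb', hne, hseg'⟩ : ∃ b' ∈ C, a ≠ b' ∧ ∀ v ∈ V, v ∈ segment ℝ a b' := by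
    by_cases h : a = b
    · obtain ⟨b', hb', hne⟩ := exists_ne_mem hC a
      refine ⟨b', hb', hne.symm, fun v hv => ?_⟩
      have := hseg v hv
      rw [← h, segment_same, Set.mem_singleton_iff] at this
      rw [this]
      exact left_mem_segment ℝ _ _
    · exact ⟨b, hVC hb, h, hseg⟩
  obtain ⟨c, hc, hor⟩ := exists_orient_ne_zero hC hne
  refine ⟨a, hVC ha, b', hb', c, hc, hor, fun v hv => ?_⟩
  have : segment ℝ a b' ⊆ convexHull ℝ {a, b', c} := by
    rw [← convexHull_pair]
    exact convexHull_mono (by intro z; simp; tauto)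
  exact this (hseg' v hv)

lemma exists_polygon_sees {k : ℕ} (hk : 2 < k) {C : Set Plane} (hC : IsCompact C)
    (hconv : Convex ℝ C) (hne : C.Nonempty) :
    ∃ Q ∈ inscribedPolygons k C, ((interior C).Nonempty → (interior Q).Nonempty) ∧
      ∀ x ∈ C, Sees (Real.cos (optimalAngle k / 2)) x Q := by
  classical
  obtain ⟨v, hvC, hv⟩ := exists_tuple_sees hk hC hne
  let V : Finset Plane := Finset.univ.image v
  have hVr : (V : Set Plane) = Set.range v := by simp [V]
  have hVne : V.Nonempty := ⟨v ⟨0, by omega⟩, Finset.mem_image_of_mem _ (Finset.mem_univ _)⟩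
  have hVk : V.card ≤ k := Finset.card_image_le.trans (by simp)
  have hVC : (V : Set Plane) ⊆ C := by
    rw [hVr]; rintro _ ⟨i, rfl⟩; exact hvC i
  by_cases hgood : (interior C).Nonempty → (interior (convexHull ℝ (V : Set Plane))).Nonempty
  · refine ⟨convexHull ℝ V, ⟨convexHull_min hVC hconv, V, hVne, hVk, rfl⟩, hgood, fun x hx => ?_⟩
    exact (hv x hx).mono (hVr ▸ subset_convexHull ℝ _)
  -- Enlarging the polygon preserves `Sees`, and k > 2 permits a triangle.
  · obtain ⟨hint, hno⟩ := Classical.not_imp.1 hgood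
    rw [interior_convexHull_nonempty_iff_affineSpan_eq_top] at hno
    obtain ⟨a, ha, b, hb, c, hc, hor, hsub⟩ := exists_nondegenerate_triangle hint hVne hVC
      fun a ha b hb c hc => by
        by_contra h
        exact hno (affineSpan_eq_top_of_orient ha hb hc h)
    have hsubC : ({a, b, c} : Set Plane) ⊆ C := by
      rintro z (rfl | rfl | rfl) <;> assumption
    refine ⟨convexHull ℝ {a, b, c}, ⟨convexHull_min hsubC hconv, {a, b, c},
      Finset.insert_nonempty _ _, Finset.card_le_three.trans hk, by simp⟩, fun _ => ?_,
      fun x hx => (hv x hx).mono (hVr ▸ hsub)⟩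
    rw [interior_convexHull_nonempty_iff_affineSpan_eq_top]
    exact affineSpan_eq_top_of_orient (by simp) (by simp) (by simp) hor

lemma le_apertureOf_of_sees {α : ℝ} (h1 : α ≤ Real.pi) {C Q : Set Plane} (hne : C.Nonempty)
    (h : ∀ x ∈ C, Sees (Real.cos (α / 2)) x Q) : α ≤ apertureOf C Q := by
  refine le_csInf (hne.image _) ?_
  rintro _ ⟨x, hx, rfl⟩
  exact le_apertureAngle_of_sees h1 (h x hx)

lemma exists_inscribedPolygon {k : ℕ} (hk : 2 < k) {C : Set Plane} (hC : IsCompact C)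
    (hconv : Convex ℝ C) (hne : C.Nonempty) :
    ∃ Q ∈ inscribedPolygons k C, ((interior C).Nonempty → (interior Q).Nonempty) ∧
      optimalAngle k ≤ apertureOf C Q := by
  obtain ⟨Q, hQ, hint, hsee⟩ := exists_polygon_sees hk hC hconv hne
  exact ⟨Q, hQ, hint, le_apertureOf_of_sees (optimalAngle_lt_pi k).le hne hsee⟩

/-! ### Regular polygons and sharpness. -/

/-- The vertices of a regular polygon. -/
def regularVertex (n : ℕ) (c : Plane) (r φ : ℝ) (j : Fin n) : Plane :=
  c + r • (!₂[Real.cos (φ + 2 * Real.pi * (j : ℝ) / (n : ℝ)),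
    Real.sin (φ + 2 * Real.pi * (j : ℝ) / (n : ℝ))] : Plane)

lemma optimalAngle_eq (k : ℕ) : optimalAngle k = Real.pi - 2 * Real.pi / ((k + 1 : ℕ) : ℝ) := by
  unfold optimalAngle
  push_cast
  ring

lemma two_mul_cos_half_optimalAngle_sq (k : ℕ) :
    2 * Real.cos (optimalAngle k / 2) ^ 2 = 1 - Real.cos (2 * Real.pi / ((k + 1 : ℕ) : ℝ)) := by
  rw [Real.cos_sq, mul_div_cancel₀ _ (two_ne_zero' ℝ), optimalAngle_eq, Real.cos_pi_sub]
  ring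

lemma cos_half_optimalAngle_pos {k : ℕ} (hk : 2 < k) : 0 < Real.cos (optimalAngle k / 2) := by
  have h1 := optimalAngle_pos hk
  have h2 := optimalAngle_lt_pi k
  exact Real.cos_pos_of_mem_Ioo ⟨by linarith, by linarith⟩

/-- The difference of the two polar angles is, up to sign, between 2π/n and 2π − 2π/n. -/
lemma cos_le_of_ne {n : ℕ} {i j : Fin n} (h : i ≠ j) (φ : ℝ) :
    Real.cos ((φ + 2 * Real.pi * (i : ℝ) / (n : ℝ)) - (φ + 2 * Real.pi * (j : ℝ) / (n : ℝ))) ≤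
      Real.cos (2 * Real.pi / (n : ℝ)) := by
  wlog hij : j < i generalizing i j
  · rw [← Real.cos_neg, neg_sub]
    exact this h.symm (lt_of_le_of_ne (not_lt.1 hij) h)
  have hn : (0 : ℝ) < n := by exact_mod_cast i.pos
  have h1 : (j : ℝ) + 1 ≤ i := by exact_mod_cast hij
  have h2 : (i : ℝ) + 1 ≤ n := by exact_mod_cast i.isLt
  have h3 : (0 : ℝ) ≤ (j : ℕ) := Nat.cast_nonneg _
  set x := 2 * Real.pi / (n : ℝ) with hx
  have hx0 : 0 < x := by have := Real.pi_pos; positivity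
  have hnx : n * x = 2 * Real.pi := by rw [hx]; field_simp
  rw [show (φ + 2 * Real.pi * (i : ℝ) / (n : ℝ)) - (φ + 2 * Real.pi * (j : ℝ) / (n : ℝ)) =
    ((i : ℝ) - j) * x by rw [hx]; ring]
  have h4 : x ≤ ((i : ℝ) - j) * x := by nlinarith
  have h5 : ((i : ℝ) - j) * x ≤ 2 * Real.pi - x := by nlinarith
  rcases le_total (((i : ℝ) - j) * x) Real.pi with h6 | h6
  · exact Real.cos_le_cos_of_nonneg_of_le_pi hx0.le h6 h4
  · rw [← Real.cos_two_pi_sub]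
    exact Real.cos_le_cos_of_nonneg_of_le_pi hx0.le (by linarith) (by linarith)

lemma inner_regularVertex (n : ℕ) (c : Plane) (r φ : ℝ) (i j : Fin n) :
    ⟪regularVertex n c r φ i - regularVertex n c r φ j, c - regularVertex n c r φ j⟫ =
      r ^ 2 * (1 - Real.cos ((φ + 2 * Real.pi * (i : ℝ) / (n : ℝ)) -
        (φ + 2 * Real.pi * (j : ℝ) / (n : ℝ)))) := by
  rw [inner_sub_sub, Real.cos_sub]
  simp only [dotAt, regularVertex, PiLp.add_apply, PiLp.smul_apply, smul_eq_mul,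
    Matrix.cons_val_zero, Matrix.cons_val_one]
  linear_combination r ^ 2 * Real.sin_sq_add_cos_sq (φ + 2 * Real.pi * (j : ℝ) / (n : ℝ))

lemma norm_sub_regularVertex_sq (n : ℕ) (c : Plane) (r φ : ℝ) (i j : Fin n) :
    ‖regularVertex n c r φ i - regularVertex n c r φ j‖ ^ 2 =
      2 * r ^ 2 * (1 - Real.cos ((φ + 2 * Real.pi * (i : ℝ) / (n : ℝ)) -
        (φ + 2 * Real.pi * (j : ℝ) / (n : ℝ)))) := by
  rw [← real_inner_self_eq_norm_sq, inner_sub_sub, Real.cos_sub]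
  simp only [dotAt, regularVertex, PiLp.add_apply, PiLp.smul_apply, smul_eq_mul,
    Matrix.cons_val_zero, Matrix.cons_val_one]
  linear_combination r ^ 2 * Real.sin_sq_add_cos_sq (φ + 2 * Real.pi * (j : ℝ) / (n : ℝ)) +
    r ^ 2 * Real.sin_sq_add_cos_sq (φ + 2 * Real.pi * (i : ℝ) / (n : ℝ))

lemma norm_center_sub_regularVertex {n : ℕ} {c : Plane} {r φ : ℝ} (hr : 0 < r) (j : Fin n) :
    ‖c - regularVertex n c r φ j‖ = r := by
  have : ‖c - regularVertex n c r φ j‖ ^ 2 = r ^ 2 := by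
    rw [← real_inner_self_eq_norm_sq, inner_sub_sub]
    simp only [dotAt, regularVertex, PiLp.add_apply, PiLp.smul_apply, smul_eq_mul,
      Matrix.cons_val_zero, Matrix.cons_val_one]
    linear_combination r ^ 2 * Real.sin_sq_add_cos_sq (φ + 2 * Real.pi * (j : ℝ) / (n : ℝ))
  exact (pow_left_inj₀ (norm_nonneg _) hr.le two_ne_zero).1 this

lemma cos_two_pi_div_lt_one {k : ℕ} (hk : 2 < k) :
    Real.cos (2 * Real.pi / ((k + 1 : ℕ) : ℝ)) < 1 := by
  have := two_mul_cos_half_optimalAngle_sq k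
  have := cos_half_optimalAngle_pos hk
  nlinarith

lemma regularVertex_injective {k : ℕ} (hk : 2 < k) {c : Plane} {r φ : ℝ} (hr : 0 < r) :
    Function.Injective (regularVertex (k + 1) c r φ) := by
  intro i j h
  by_contra hij
  have h1 := inner_regularVertex (k + 1) c r φ i j
  rw [h, sub_self, inner_zero_left] at h1
  have h2 := (cos_le_of_ne hij φ).trans_lt (cos_two_pi_div_lt_one hk)
  have h3 : 0 < r ^ 2 := by positivity
  have := mul_pos h3 (sub_pos.2 h2)
  linarith

lemma convex_sector (C : ℝ) (hC : 0 ≤ C) (p w : Plane) :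
    Convex ℝ {y : Plane | C * (‖y - p‖ * ‖w‖) ≤ ⟪y - p, w⟫} := by
  intro y hy z hz a b ha hb hab
  have e : a • y + b • z - p = a • (y - p) + b • (z - p) := by
    obtain rfl : b = 1 - a := by linarith
    module
  change C * (‖y - p‖ * ‖w‖) ≤ ⟪y - p, w⟫ at hy
  change C * (‖z - p‖ * ‖w‖) ≤ ⟪z - p, w⟫ at hz
  change C * (‖a • y + b • z - p‖ * ‖w‖) ≤ ⟪a • y + b • z - p, w⟫
  rw [e, inner_add_left, real_inner_smul_left, real_inner_smul_left]
  have hn : ‖a • (y - p) + b • (z - p)‖ ≤ a * ‖y - p‖ + b * ‖z - p‖ := by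
    refine (norm_add_le _ _).trans_eq ?_
    rw [norm_smul, norm_smul, Real.norm_of_nonneg ha, Real.norm_of_nonneg hb]
  calc C * (‖a • (y - p) + b • (z - p)‖ * ‖w‖)
      ≤ C * ((a * ‖y - p‖ + b * ‖z - p‖) * ‖w‖) := by gcongr
    _ = a * (C * (‖y - p‖ * ‖w‖)) + b * (C * (‖z - p‖ * ‖w‖)) := by ring
    _ ≤ _ := by gcongr

/-- The sector is convex, so vertices suffice. There the inner product is r²t and the squared
distance 2r²t, with t one minus the cosine of the central angle, so the claim reduces to
2cos²(α_k/2) ≤ t. -/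
lemma regularPolygon_subset_sector {k : ℕ} (hk : 2 < k) {c : Plane} {r φ : ℝ} (hr : 0 < r)
    (j : Fin (k + 1)) :
    regularPolygon (k + 1) c r φ ⊆
      {y : Plane | Real.cos (optimalAngle k / 2) * (‖y - regularVertex (k + 1) c r φ j‖ *
        ‖c - regularVertex (k + 1) c r φ j‖) ≤
        ⟪y - regularVertex (k + 1) c r φ j, c - regularVertex (k + 1) c r φ j⟫} := by
  have hC := cos_half_optimalAngle_pos hk
  refine convexHull_min ?_ (convex_sector _ hC.le _ _)
  rintro _ ⟨i, rfl⟩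
  change _ * (‖regularVertex (k + 1) c r φ i - _‖ * _) ≤ ⟪regularVertex (k + 1) c r φ i - _, _⟫
  by_cases hij : i = j
  · simp [hij]
  rw [norm_center_sub_regularVertex hr]
  have hcos := cos_le_of_ne hij φ
  have hC2 := two_mul_cos_half_optimalAngle_sq k
  have hin := inner_regularVertex (k + 1) c r φ i j
  have hno := norm_sub_regularVertex_sq (k + 1) c r φ i j
  set t := 1 - Real.cos ((φ + 2 * Real.pi * (i : ℝ) / ((k + 1 : ℕ) : ℝ)) -
        (φ + 2 * Real.pi * (j : ℝ) / ((k + 1 : ℕ) : ℝ))) with ht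
  have ht1 : 2 * Real.cos (optimalAngle k / 2) ^ 2 ≤ t := by linarith
  have ht0 : 0 ≤ t := le_trans (by positivity) ht1
  rw [hin]
  refine (pow_le_pow_iff_left₀ (by positivity) (by positivity) two_ne_zero).1 ?_
  calc _ = Real.cos (optimalAngle k / 2) ^ 2 * (‖regularVertex (k + 1) c r φ i -
            regularVertex (k + 1) c r φ j‖ ^ 2) * r ^ 2 := by ring
    _ = (2 * Real.cos (optimalAngle k / 2) ^ 2) * (r ^ 4 * t) := by rw [hno]; ring
    _ ≤ t * (r ^ 4 * t) := by gcongr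
    _ = _ := by ring

lemma apertureAngle_nonneg (x : Plane) (Q : Set Plane) : 0 ≤ apertureAngle x Q := by
  unfold apertureAngle
  split_ifs
  · exact Real.pi_pos.le
  · exact Real.sInf_nonneg fun θ hθ => hθ.1.1

lemma apertureOf_le {C Q : Set Plane} {x : Plane} (hx : x ∈ C) :
    apertureOf C Q ≤ apertureAngle x Q :=
  csInf_le ⟨0, by rintro _ ⟨y, -, rfl⟩; exact apertureAngle_nonneg y Q⟩ ⟨x, hx, rfl⟩

lemma apertureAngle_le_of_sector {α : ℝ} (h0 : 0 ≤ α) (h1 : α < Real.pi) {p w : Plane}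
    (hw : w ≠ 0) {Q : Set Plane} (hp : p ∉ Q)
    (hQ : ∀ y ∈ Q, Real.cos (α / 2) * (‖y - p‖ * ‖w‖) ≤ ⟪y - p, w⟫) :
    apertureAngle p Q ≤ α := by
  unfold apertureAngle
  rw [if_neg hp]
  refine csInf_le ⟨0, fun θ hθ => hθ.1.1⟩ ⟨⟨h0, by linarith⟩, w, hw, fun y hy => ?_⟩
  right
  have hyp : y ≠ p := fun e => hp (e ▸ hy)
  have h := hQ y hy
  rw [← InnerProductGeometry.cos_angle_mul_norm_mul_norm] at h
  have hpos : 0 < ‖y - p‖ * ‖w‖ :=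
    mul_pos (norm_pos_iff.2 (sub_ne_zero.2 hyp)) (norm_pos_iff.2 hw)
  have h' := le_of_mul_le_mul_right h hpos
  by_contra! hlt
  have := Real.cos_lt_cos_of_nonneg_of_le_pi (by linarith : 0 ≤ α / 2)
    (InnerProductGeometry.angle_le_pi (y - p) w) hlt
  linarith

lemma apertureOf_regularPolygon_le {k : ℕ} (hk : 2 < k) {c : Plane} {r φ : ℝ} (hr : 0 < r)
    {Q : Set Plane} (hQ : Q ∈ inscribedPolygons k (regularPolygon (k + 1) c r φ)) :
    apertureOf (regularPolygon (k + 1) c r φ) Q ≤ optimalAngle k := by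
  classical
  obtain ⟨hQP, V, -, hVk, rfl⟩ := hQ
  -- At most k points cannot include all k + 1 vertices.
  obtain ⟨j, hj⟩ : ∃ j, regularVertex (k + 1) c r φ j ∉ V := by
    by_contra! h
    have h1 : Finset.univ.image (regularVertex (k + 1) c r φ) ⊆ V := fun y hy => by
      obtain ⟨j, -, rfl⟩ := Finset.mem_image.1 hy
      exact h j
    have h2 := Finset.card_le_card h1
    rw [Finset.card_image_of_injective _ (regularVertex_injective hk hr), Finset.card_univ,
      Fintype.card_fin] at h2
    omega
  have hsec := hQP.trans (regularPolygon_subset_sector hk hr j)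
  set p := regularVertex (k + 1) c r φ j with hp
  have hw : ‖c - p‖ = r := norm_center_sub_regularVertex hr j
  have hlin : IsLinearMap ℝ (fun y : Plane => ⟪y, c - p⟫) :=
    ⟨fun a b => inner_add_left _ _ _, fun r a => by simp [real_inner_smul_left]⟩
  -- The half-angle is below π/2, so sector points other than `p` are strictly in front of the line
  -- through `p` orthogonal to the axis; hence `p ∉ Q`.
  have hsub : (V : Set Plane) ⊆ {y : Plane | ⟪p, c - p⟫ < ⟪y, c - p⟫} := fun y hy => by
    have h1 : _ ≤ ⟪y - p, c - p⟫ := hsec (subset_convexHull ℝ _ hy)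
    have hyp : y ≠ p := fun e => hj (e ▸ hy)
    have h2 : 0 < ‖y - p‖ := norm_pos_iff.2 (sub_ne_zero.2 hyp)
    have h3 : 0 < Real.cos (optimalAngle k / 2) * (‖y - p‖ * ‖c - p‖) := by
      rw [hw]
      exact mul_pos (cos_half_optimalAngle_pos hk) (mul_pos h2 hr)
    rw [inner_sub_left] at h1
    change ⟪p, c - p⟫ < ⟪y, c - p⟫
    linarith
  have hpQ : p ∉ convexHull ℝ (V : Set Plane) := fun h =>
    lt_irrefl ⟪p, c - p⟫ (convexHull_min hsub (convex_halfSpace_gt hlin _) h)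
  have hpP : p ∈ regularPolygon (k + 1) c r φ := subset_convexHull ℝ _ ⟨j, rfl⟩
  refine (apertureOf_le hpP).trans ?_
  refine apertureAngle_le_of_sector (optimalAngle_pos hk).le (optimalAngle_lt_pi k) ?_ hpQ
    fun y hy => hsec hy
  rw [← norm_pos_iff, hw]
  exact hr

lemma isCompact_regularPolygon (n : ℕ) (c : Plane) (r φ : ℝ) :
    IsCompact (regularPolygon n c r φ) :=
  (Set.finite_range _).isCompact_convexHull (𝕜 := ℝ)

lemma regularPolygon_nonempty (n : ℕ) (c : Plane) (r φ : ℝ) :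
    (regularPolygon (n + 1) c r φ).Nonempty :=
  (Set.range_nonempty _).convexHull

lemma isGreatest_regularPolygon {k : ℕ} (hk : 2 < k) (c : Plane) {r : ℝ} (φ : ℝ) (hr : 0 < r) :
    IsGreatest ((fun Q => apertureOf (regularPolygon (k + 1) c r φ) Q) ''
      inscribedPolygons k (regularPolygon (k + 1) c r φ)) (optimalAngle k) := by
  constructor
  · obtain ⟨Q, hQ, -, hle⟩ := exists_inscribedPolygon hk (isCompact_regularPolygon (k + 1) c r φ)
      (convex_convexHull ℝ _) (regularPolygon_nonempty k c r φ)
    exact ⟨Q, hQ, (apertureOf_regularPolygon_le hk hr hQ).antisymm hle⟩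
  · rintro _ ⟨Q, hQ, rfl⟩
    exact apertureOf_regularPolygon_le hk hr hQ

/-! ### The value of α(k). -/

lemma apertureAngle_le {x : Plane} {Q : Set Plane} : apertureAngle x Q ≤ 2 * Real.pi := by
  have hpi := Real.pi_pos
  unfold apertureAngle
  split_ifs
  · linarith
  refine csInf_le ⟨0, fun θ hθ => hθ.1.1⟩
    ⟨⟨by positivity, le_rfl⟩, EuclideanSpace.single 0 1, fun h => ?_, fun y _ => ?_⟩
  · have := congrArg (fun z : Plane => z 0) h
    simp at this
  · right
    have := InnerProductGeometry.angle_le_pi (y - x) (EuclideanSpace.single 0 1)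
    linarith

lemma optimalAngle_le_bestAperture {k : ℕ} (hk : 2 < k) {C : Set Plane} (hC : IsCompact C)
    (hconv : Convex ℝ C) (hne : C.Nonempty) : optimalAngle k ≤ bestAperture C k := by
  obtain ⟨Q, hQ, -, hle⟩ := exists_inscribedPolygon hk hC hconv hne
  obtain ⟨x, hx⟩ := hne
  refine hle.trans (le_csSup ⟨2 * Real.pi, ?_⟩ ⟨Q, hQ, rfl⟩)
  rintro _ ⟨R, -, rfl⟩
  exact (apertureOf_le hx).trans apertureAngle_le

lemma guaranteedAperture_eq {k : ℕ} (hk : 2 < k) : guaranteedAperture k = optimalAngle k := by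
  have hlow : ∀ y ∈ (fun C => bestAperture C k) ''
      {C : Set Plane | IsCompact C ∧ Convex ℝ C ∧ C.Nonempty}, optimalAngle k ≤ y := by
    rintro _ ⟨C, ⟨hC, hconv, hne⟩, rfl⟩
    exact optimalAngle_le_bestAperture hk hC hconv hne
  -- The infimum is attained, by the regular (k+1)-gon.
  have hmem : optimalAngle k ∈ (fun C => bestAperture C k) ''
      {C : Set Plane | IsCompact C ∧ Convex ℝ C ∧ C.Nonempty} :=
    ⟨regularPolygon (k + 1) 0 1 0, ⟨isCompact_regularPolygon _ _ _ _, convex_convexHull ℝ _,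
      regularPolygon_nonempty _ _ _ _⟩, (isGreatest_regularPolygon hk 0 0 one_pos).csSup_eq⟩
  exact (show IsLeast _ _ from ⟨hmem, hlow⟩).csInf_eq

end Aperture

end

theorem theorem1 (k : ℕ) (hk : 2 < k) :
    (∀ C : Set Aperture.Plane, IsCompact C → Convex ℝ C → C.Nonempty →
      ∃ Q ∈ Aperture.inscribedPolygons k C,
        ((interior C).Nonempty → (interior Q).Nonempty) ∧
        (1 - 2 / ((k : ℝ) + 1)) * Real.pi ≤ Aperture.apertureOf C Q) ∧
    (∀ (c : Aperture.Plane) (r φ : ℝ), 0 < r →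
      IsGreatest
        ((fun Q => Aperture.apertureOf (Aperture.regularPolygon (k + 1) c r φ) Q) ''
          Aperture.inscribedPolygons k (Aperture.regularPolygon (k + 1) c r φ))
        ((1 - 2 / ((k : ℝ) + 1)) * Real.pi)) ∧
    Aperture.guaranteedAperture k = (1 - 2 / ((k : ℝ) + 1)) * Real.pi := by
  exact ⟨fun C hC hconv hne => Aperture.exists_inscribedPolygon hk hC hconv hne,
    fun c r φ hr => Aperture.isGreatest_regularPolygon hk c φ hr,
    Aperture.guaranteedAperture_eq hk⟩
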